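/- **Corollary 2.1.** Let $(\varepsilon_n)_{n\in\mathbb Z}$ be i.i.d. random elements of a measurable space, and let $X_n=G(\dots,\varepsilon_{n-1},\varepsilon_n)$, $n\in\mathbb Z$, where $G$ is a real-valued measurable function, with $\mathbb E X_n=0$ and $\mathbb E X_n^2<\infty$. Let $\mathcal F_k=\sigma(\dots,\varepsilon_{k-1},\varepsilon_k)$, $\mathcal P_0\xi=\mathbb E(\xi\mid\mathcal F_0)-\mathbb E(\xi\mid\mathcal F_{-1})$, $\|\xi\|=(\mathbb E\xi^2)^{1/2}$, $r(k)=\mathbb E(X_0X_k)$, and $$f(\theta)=\frac1{2\pi}\sum_{k\in\mathbb Z}r(k)e^{ik\theta},\qquad S_n(\theta)=\sum_{k=1}^nX_ke^{ik\theta},\qquad I_n(\theta)=\frac{1}{2\pi n}|S_n(\theta)|^2,\qquad \theta_k=\frac{2\pi k}{n}.$$ Assume that $$\sum_{k=0}^\infty\|\mathcal P_0X_k\|<\infty\qquad\text{and}\qquad \inf_{\theta\in\mathbb R}f(\theta)>0 .$$ Let $q\in\mathbb N$ and, for all large $n$, let $1\le l_1<l_2<\dots<l_q\le\lfloor(n-1)/2\rfloor$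 be integers, which may depend on $n$. Then, as $n\to\infty$, $$\left\{\frac{S_n(\theta_{l_j})}{\sqrt{n\pi f(\theta_{l_j})}},\ 1\le j\le q\right\}\Rightarrow\{Y_{2j-1}+iY_{2j},\ 1\le j\le q\}$$ jointly in distribution, where $Y_1,\dots,Y_{2q}$ are i.i.d. standard (real) normal random variables. Consequently, $$\left\{\frac{I_n(\theta_{l_j})}{f(\theta_{l_j})},\ 1\le j\le q\right\}\Rightarrow\{E_j,\ 1\le j\le q\}$$ jointly in distribution, where $E_1,\dots,E_q$ are i.i.d. standard exponential random variables. -/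

import Mathlib

open MeasureTheory ProbabilityTheory Filter
open scoped ENNReal Topology

noncomputable section

namespace SpectralTS

variable {Ω S : Type*}

/-- The causal process `X n = G (…, ε (n - 1), ε n)`. The past is listed backwards in time:
coordinate `j : ℕ` of the argument of `G` is the innovation `ε (n - j)`. -/
def causalProcess (G : (ℕ → S) → ℝ) (ε : ℤ → Ω → S) (n : ℤ) (ω : Ω) : ℝ :=
  G (fun j : ℕ => ε (n - (j : ℤ)) ω)

/-- The sigma-algebra `F k = σ(…, ε (k - 1), ε k)` generated by the innovations up to time `k`. -/
abbrev past [MeasurableSpace S] (ε : ℤ → Ω → S) (k : ℤ) : MeasurableSpace Ω :=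
  ⨆ j ∈ Set.Iic k, MeasurableSpace.comap (ε j) inferInstance

/-- The projection `P k ξ = E(ξ | F k) - E(ξ | F (k - 1))`. -/
def proj [MeasurableSpace Ω] [MeasurableSpace S] (μ : Measure Ω) (ε : ℤ → Ω → S) (k : ℤ)
    (ξ : Ω → ℝ) : Ω → ℝ :=
  μ[ξ | past ε k] - μ[ξ | past ε (k - 1)]

/-- The covariance function `r k = E(X 0 * X k)` (of a mean zero process). -/
def cov [MeasurableSpace Ω] (μ : Measure Ω) (X : ℤ → Ω → ℝ) (k : ℤ) : ℝ :=
  ∫ ω, X 0 ω * X k ω ∂μ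

/-- The spectral density `f t = (1 / 2π) ∑_{k ∈ ℤ} r k * exp (i k t)`. For a stationary process
`r` is even, so that the sum is real; the real part only serves to land in `ℝ`. -/
def spectralDensity [MeasurableSpace Ω] (μ : Measure Ω) (X : ℤ → Ω → ℝ) (t : ℝ) : ℝ :=
  (1 / (2 * (Real.pi : ℂ)) *
    ∑' k : ℤ, (cov μ X k : ℂ) * Complex.exp (Complex.I * (k : ℂ) * (t : ℂ))).re

/-- The Fourier transform `S_n(t) = ∑_{k = 1}^n X k * exp (i k t)`. -/
def fourierSum (X : ℤ → Ω → ℝ) (n : ℕ) (t : ℝ) (ω : Ω) : ℂ :=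
  ∑ k ∈ Finset.Icc 1 n, (X (k : ℤ) ω : ℂ) * Complex.exp (Complex.I * (k : ℂ) * (t : ℂ))

/-- The periodogram `I_n(t) = |S_n(t)|² / (2πn)`. -/
def periodogram (X : ℤ → Ω → ℝ) (n : ℕ) (t : ℝ) (ω : Ω) : ℝ :=
  1 / (2 * Real.pi * (n : ℝ)) * ‖fourierSum X n t ω‖ ^ 2

/-- The Fourier frequency `2πk/n`. -/
def fourierFreq (n k : ℕ) : ℝ := 2 * Real.pi * (k : ℝ) / (n : ℝ)

end SpectralTS

end

/-! The innovations up to any time, read backwards, form a one-sided i.i.d. sequence, so `X t` is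
one fixed function `f` of that sequence. Integrating out the newest letter (`avg`) plays the role of
conditioning on the previous past. For centred `f` the iterates of `avg` tend to `0` in L², so `f`
splits into shifted copies of the increments `incrIter ν f j`, whose L² norms are the numbers `‖P₀
X_j‖`. For fixed `j` these copies are orthogonal in time, so a sum of `n` of them with weights
bounded by `C` has norm at most `C √n ‖P₀ X_j‖`. Since the norms are summable, `X` can be replaced
by a bounded function of finitely many innovations at a cost `η C √n`, uniformly in the weights
(`exists_finDep_approx`). The same splitting shows that the covariances are absolutely summable.

By Lévy's continuity theorem it is enough to study a real linear functional of the normalized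
Fourier transforms. This is `n^(-1/2) ∑ w X_t` with bounded weights, a trigonometric polynomial at
Fourier frequencies. For finitely dependent summands a Stein–Tikhomirov argument applies: the
characteristic function almost solves the Gaussian differential equation, so it is `O(n^(-1/2))`
away from the Gaussian one with the same variance (`norm_integral_phase_sum_sub_exp_le`). Only the
variance remains.

The variance is a Toeplitz form in the covariances. Summability makes the edge effects `o(n)`. Away
from the edges, exponentials are eigenfunctions of convolution by `r` with eigenvalue `2πf(θ)`, and
distinct Fourier frequencies are orthogonal. The normalization cancels the eigenvalues exactly, so
`f` need not converge along the moving frequencies; the lower bound on `f` serves to keep the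
weights bounded. The periodogram limit follows by continuous mapping, because half the sum of two
squared standard normals is standard exponential. -/

noncomputable section

namespace SpectralTS

/-! ### One-sided i.i.d. sequences: shift and averaging -/

section SequenceSpace

variable {S : Type*}

/-- Prepend a letter to a one-sided sequence. -/
def seqCons (s : S) (v : ℕ → S) : ℕ → S
  | 0 => s
  | k + 1 => v k

/-- Drop the first `d` letters of a one-sided sequence. -/
def seqShift (d : ℕ) (v : ℕ → S) : ℕ → S := fun k => v (k + d)

@[simp] lemma seqShift_zero (v : ℕ → S) : seqShift 0 v = v := rfl

@[simp] lemma seqShift_one_seqCons (s : S) (v : ℕ → S) : seqShift 1 (seqCons s v) = v := rfl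

lemma seqShift_seqShift (d e : ℕ) (v : ℕ → S) :
    seqShift d (seqShift e v) = seqShift (d + e) v := by
  funext k; simp [seqShift, add_assoc]

variable [MeasurableSpace S]

lemma measurable_seqCons : Measurable (fun p : S × (ℕ → S) => seqCons p.1 p.2) := by
  refine measurable_pi_iff.2 fun k => ?_
  cases k with
  | zero => exact measurable_fst
  | succ k => exact (measurable_pi_apply k).comp measurable_snd

@[fun_prop] lemma measurable_seqShift (d : ℕ) : Measurable (seqShift d : (ℕ → S) → ℕ → S) :=
  measurable_pi_iff.2 fun k => measurable_pi_apply (k + d)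

/-- The law of a one-sided i.i.d. sequence with marginal `ν`. -/
abbrev seqMeasure (ν : Measure S) [IsProbabilityMeasure ν] : Measure (ℕ → S) :=
  Measure.infinitePi (fun _ : ℕ => ν)

/-- Average out the first letter. -/
def avg (ν : Measure S) (f : (ℕ → S) → ℝ) (v : ℕ → S) : ℝ := ∫ s, f (seqCons s v) ∂ν

/-- The increment of `f` due to the first letter. -/
def incr (ν : Measure S) (f : (ℕ → S) → ℝ) (v : ℕ → S) : ℝ := f v - avg ν f (seqShift 1 v)

variable (ν : Measure S) [IsProbabilityMeasure ν] {f g : (ℕ → S) → ℝ}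

/-- The product law is determined by its values on boxes, and the preimage of a box is again a box:
the constraint on letter `0`, times the remaining constraints moved down by one index. -/
lemma measurePreserving_seqCons :
    MeasurePreserving (fun p : S × (ℕ → S) => seqCons p.1 p.2) (ν.prod (seqMeasure ν))
      (seqMeasure ν) := by
  refine ⟨measurable_seqCons, ?_⟩
  refine Measure.eq_infinitePi _ fun s t ht => ?_
  have hpre : (fun p : S × (ℕ → S) => seqCons p.1 p.2) ⁻¹' (Set.pi s t) =
      (if 0 ∈ s then t 0 else Set.univ) ×ˢ
        Set.pi ((s.erase 0).image Nat.pred : Finset ℕ) (fun k => t (k + 1)) := by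
    ext p
    simp only [Set.mem_preimage, Set.mem_pi, Finset.mem_coe, Set.mem_prod, Finset.mem_image,
      Finset.mem_erase]
    constructor
    · intro h
      refine ⟨?_, ?_⟩
      · split_ifs with h0
        · exact h 0 h0
        · trivial
      · rintro i ⟨a, ⟨ha0, ha⟩, rfl⟩
        obtain ⟨b, rfl⟩ := Nat.exists_eq_succ_of_ne_zero ha0
        exact h _ ha
    · rintro ⟨h1, h2⟩ i hi
      cases i with
      | zero => rw [if_pos hi] at h1; exact h1
      | succ k => exact h2 k ⟨k + 1, ⟨by simp, hi⟩, rfl⟩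
  rw [Measure.map_apply measurable_seqCons
    (MeasurableSet.pi s.countable_toSet fun i _ => ht i), hpre, Measure.prod_prod,
    Measure.infinitePi_pi _ (fun i _ => ht _), Finset.prod_image]
  · have : ∀ x ∈ s.erase 0, ν (t (Nat.pred x + 1)) = ν (t x) := by
      intro x hx
      obtain ⟨b, rfl⟩ := Nat.exists_eq_succ_of_ne_zero (Finset.ne_of_mem_erase hx)
      rfl
    rw [Finset.prod_congr rfl this]
    split_ifs with h0
    · exact Finset.mul_prod_erase s (fun i => ν (t i)) h0
    · rw [Finset.erase_eq_of_notMem h0]; simp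
  · intro a ha b hb hab
    have := Finset.ne_of_mem_erase ha
    have := Finset.ne_of_mem_erase hb
    simp only [Nat.pred_eq_sub_one] at hab
    omega

lemma measurePreserving_seqShift_one :
    MeasurePreserving (seqShift 1) (seqMeasure ν) (seqMeasure ν) := by
  refine ⟨measurable_seqShift 1, ?_⟩
  conv_lhs => rw [← (measurePreserving_seqCons ν).map_eq]
  rw [Measure.map_map (measurable_seqShift 1) measurable_seqCons]
  exact Measure.map_snd_prod.trans (by simp)

lemma measurePreserving_seqShift (d : ℕ) :
    MeasurePreserving (seqShift d) (seqMeasure ν) (seqMeasure ν) := by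
  induction d with
  | zero => exact MeasurePreserving.id _
  | succ d ih =>
    have h := (measurePreserving_seqShift_one ν).comp ih
    have he : seqShift 1 ∘ seqShift d = (seqShift (d + 1) : (ℕ → S) → ℕ → S) := by
      funext v; simp [seqShift_seqShift, add_comm]
    rwa [he] at h

lemma measurable_avg (hf : Measurable f) : Measurable (avg ν f) := by
  have h : StronglyMeasurable (fun p : S × (ℕ → S) => f (seqCons p.1 p.2)) :=
    (hf.comp measurable_seqCons).stronglyMeasurable
  exact (h.integral_prod_left' (μ := ν)).measurable

lemma lintegral_seqMeasure {F : (ℕ → S) → ℝ≥0∞} (hF : Measurable F) :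
    ∫⁻ v, F v ∂(seqMeasure ν) = ∫⁻ v, ∫⁻ s, F (seqCons s v) ∂ν ∂(seqMeasure ν) := by
  rw [← (measurePreserving_seqCons ν).lintegral_comp hF, lintegral_prod_symm']
  exact hF.comp measurable_seqCons

lemma integrable_seqCons (hf : Integrable f (seqMeasure ν)) :
    Integrable (fun p : S × (ℕ → S) => f (seqCons p.1 p.2)) (ν.prod (seqMeasure ν)) :=
  (measurePreserving_seqCons ν).integrable_comp_of_integrable hf

lemma integral_avg (hf : Integrable f (seqMeasure ν)) :
    ∫ v, avg ν f v ∂(seqMeasure ν) = ∫ v, f v ∂(seqMeasure ν) := by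
  have h := integral_map (φ := fun p : S × (ℕ → S) => seqCons p.1 p.2) (μ := ν.prod (seqMeasure ν))
    (f := f) measurable_seqCons.aemeasurable
    (by rw [(measurePreserving_seqCons ν).map_eq]; exact hf.aestronglyMeasurable)
  rw [(measurePreserving_seqCons ν).map_eq] at h
  rw [h, integral_prod_symm _ (integrable_seqCons ν hf)]
  rfl

lemma ae_integrable_seqCons (hf : Integrable f (seqMeasure ν)) :
    ∀ᵐ v ∂(seqMeasure ν), Integrable (fun s => f (seqCons s v)) ν :=
  (integrable_seqCons ν hf).prod_left_ae

lemma avg_sub_ae (hf : Integrable f (seqMeasure ν)) (hg : Integrable g (seqMeasure ν)) :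
    avg ν (f - g) =ᵐ[seqMeasure ν] avg ν f - avg ν g := by
  filter_upwards [ae_integrable_seqCons ν hf, ae_integrable_seqCons ν hg] with v h1 h2
  exact integral_sub h1 h2

/-- Jensen in the first letter for each fixed tail (`L¹ ≤ L²` for the probability `ν`), then
Tonelli. -/
lemma eLpNorm_avg_le (hf : Measurable f) :
    eLpNorm (avg ν f) 2 (seqMeasure ν) ≤ eLpNorm f 2 (seqMeasure ν) := by
  rw [eLpNorm_eq_lintegral_rpow_enorm_toReal (by simp) (by simp),
    eLpNorm_eq_lintegral_rpow_enorm_toReal (by simp) (by simp)]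
  refine ENNReal.rpow_le_rpow ?_ (by positivity)
  rw [lintegral_seqMeasure ν (F := fun v => ‖f v‖ₑ ^ (2 : ℝ≥0∞).toReal) (by fun_prop)]
  refine lintegral_mono fun v => ?_
  have hm : Measurable fun s => f (seqCons s v) :=
    hf.comp (measurable_seqCons.comp (measurable_id.prodMk measurable_const))
  have h1 : ‖avg ν f v‖ₑ ≤ eLpNorm (fun s => f (seqCons s v)) 2 ν :=
    calc ‖avg ν f v‖ₑ ≤ ∫⁻ s, ‖f (seqCons s v)‖ₑ ∂ν := enorm_integral_le_lintegral_enorm _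
      _ = eLpNorm (fun s => f (seqCons s v)) 1 ν := eLpNorm_one_eq_lintegral_enorm.symm
      _ ≤ _ := eLpNorm_le_eLpNorm_of_exponent_le (by norm_num) hm.aestronglyMeasurable
  calc ‖avg ν f v‖ₑ ^ (2 : ℝ≥0∞).toReal
      ≤ (eLpNorm (fun s => f (seqCons s v)) 2 ν) ^ (2 : ℝ≥0∞).toReal := by gcongr
    _ = _ := by
      rw [eLpNorm_eq_lintegral_rpow_enorm_toReal (by simp) (by simp), ← ENNReal.rpow_mul]
      simp

lemma memLp_avg (hf : Measurable f) (h2 : MemLp f 2 (seqMeasure ν)) :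
    MemLp (avg ν f) 2 (seqMeasure ν) :=
  ⟨(measurable_avg ν hf).aestronglyMeasurable, (eLpNorm_avg_le ν hf).trans_lt h2.2⟩

/-- Averaging is the L² adjoint of composition with the shift. All orthogonality and conditional
expectation statements below rest on this duality. -/
lemma integral_avg_mul (hf2 : MemLp f 2 (seqMeasure ν)) (hg2 : MemLp g 2 (seqMeasure ν)) :
    ∫ v, avg ν f v * g v ∂(seqMeasure ν) = ∫ v, f v * g (seqShift 1 v) ∂(seqMeasure ν) := by
  have hint : Integrable (fun v => f v * g (seqShift 1 v)) (seqMeasure ν) :=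
    hf2.integrable_mul (hg2.comp_measurePreserving (measurePreserving_seqShift_one ν))
  rw [← integral_avg ν hint]
  refine integral_congr_ae (.of_forall fun v => ?_)
  simp [avg, integral_mul_const]

lemma measurable_avg_iterate (hf : Measurable f) (k : ℕ) : Measurable ((avg ν)^[k] f) := by
  induction k with
  | zero => exact hf
  | succ k ih => rw [Function.iterate_succ_apply']; exact measurable_avg ν ih

lemma memLp_avg_iterate (hf : Measurable f) (h2 : MemLp f 2 (seqMeasure ν)) (k : ℕ) :
    MemLp ((avg ν)^[k] f) 2 (seqMeasure ν) := by
  induction k with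
  | zero => exact h2
  | succ k ih =>
    rw [Function.iterate_succ_apply']; exact memLp_avg ν (measurable_avg_iterate ν hf k) ih

lemma integral_avg_iterate_mul (hf : Measurable f) (hf2 : MemLp f 2 (seqMeasure ν))
    (hg2 : MemLp g 2 (seqMeasure ν)) (k : ℕ) :
    ∫ v, (avg ν)^[k] f v * g v ∂(seqMeasure ν) =
      ∫ v, f v * g (seqShift k v) ∂(seqMeasure ν) := by
  induction k generalizing g with
  | zero => rfl
  | succ k ih =>
    rw [Function.iterate_succ_apply', integral_avg_mul ν (memLp_avg_iterate ν hf hf2 k) hg2,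
      ih (g := fun v => g (seqShift 1 v))
        (hg2.comp_measurePreserving (measurePreserving_seqShift_one ν))]
    simp only [seqShift_seqShift, add_comm]

lemma lpNorm_avg_sub_le (hf : Measurable f) (hg : Measurable g)
    (hf2 : MemLp f 2 (seqMeasure ν)) (hg2 : MemLp g 2 (seqMeasure ν)) :
    lpNorm (avg ν f - avg ν g) 2 (seqMeasure ν) ≤ lpNorm (f - g) 2 (seqMeasure ν) := by
  rw [← toReal_eLpNorm ((memLp_avg ν hf hf2).sub (memLp_avg ν hg hg2)).1,
    ← toReal_eLpNorm (hf2.sub hg2).1]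
  refine ENNReal.toReal_mono (hf2.sub hg2).2.ne ?_
  rw [← eLpNorm_congr_ae (avg_sub_ae ν (hf2.integrable one_le_two) (hg2.integrable one_le_two))]
  exact eLpNorm_avg_le ν (hf.sub hg)

lemma lpNorm_avg_iterate_sub_le (hf : Measurable f) (hg : Measurable g)
    (hf2 : MemLp f 2 (seqMeasure ν)) (hg2 : MemLp g 2 (seqMeasure ν)) (k : ℕ) :
    lpNorm ((avg ν)^[k] f - (avg ν)^[k] g) 2 (seqMeasure ν) ≤ lpNorm (f - g) 2 (seqMeasure ν) := by
  induction k with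
  | zero => exact le_rfl
  | succ k ih =>
    rw [Function.iterate_succ_apply', Function.iterate_succ_apply']
    exact (lpNorm_avg_sub_le ν (measurable_avg_iterate ν hf k) (measurable_avg_iterate ν hg k)
      (memLp_avg_iterate ν hf hf2 k) (memLp_avg_iterate ν hg hg2 k)).trans ih

end SequenceSpace

/-! ### Real L² norms and the Cauchy–Schwarz inequality -/

section SquareIntegrable

variable {α : Type*} [MeasurableSpace α] {μ : Measure α} {f g : α → ℝ}

lemma lpNorm_two_sq (hf : MemLp f 2 μ) : lpNorm f 2 μ ^ 2 = ∫ x, f x ^ 2 ∂μ := by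
  have h0 : 0 ≤ ∫ x, f x ^ 2 ∂μ := integral_nonneg fun x => sq_nonneg _
  rw [lpNorm_eq_integral_norm_rpow_toReal (by simp) (by simp) hf.1]
  simp only [ENNReal.toReal_ofNat, Real.rpow_ofNat, Real.norm_eq_abs, sq_abs]
  rw [← Real.rpow_natCast, ← Real.rpow_mul h0]
  simp

lemma lpNorm_two_eq_sqrt (hf : MemLp f 2 μ) : lpNorm f 2 μ = √(∫ x, f x ^ 2 ∂μ) := by
  rw [← lpNorm_two_sq hf, Real.sqrt_sq lpNorm_nonneg]

lemma abs_integral_mul_le_lpNorm (hf : MemLp f 2 μ) (hg : MemLp g 2 μ) :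
    |∫ x, f x * g x ∂μ| ≤ lpNorm f 2 μ * lpNorm g 2 μ := by
  have h := integral_mul_norm_le_Lp_mul_Lq (f := f) (g := g) (μ := μ)
    (Real.HolderConjugate.two_two) (by simpa using hf) (by simpa using hg)
  rw [lpNorm_eq_integral_norm_rpow_toReal (by simp) (by simp) hf.1,
    lpNorm_eq_integral_norm_rpow_toReal (by simp) (by simp) hg.1]
  refine (abs_integral_le_integral_abs).trans ?_
  simpa [abs_mul] using h

lemma lpNorm_comp_measurePreserving {β : Type*} [MeasurableSpace β] {μ' : Measure β}
    {φ : α → β} {h : β → ℝ} (hh : AEStronglyMeasurable h μ') (hφ : MeasurePreserving φ μ μ') :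
    lpNorm (fun x => h (φ x)) 2 μ = lpNorm h 2 μ' := by
  rw [← toReal_eLpNorm hh, ← toReal_eLpNorm (f := fun x => h (φ x)) (hh.comp_measurePreserving hφ)]
  exact congrArg _ (eLpNorm_comp_measurePreserving hh hφ)

lemma abs_integral_le_lpNorm_two [IsProbabilityMeasure μ] (hf : MemLp f 2 μ) :
    |∫ x, f x ∂μ| ≤ lpNorm f 2 μ := by
  have h := abs_integral_mul_le_lpNorm hf (memLp_const (1 : ℝ))
  simpa using h

lemma integrable_mul_of_memLp_two (hf : MemLp f 2 μ) (hg : MemLp g 2 μ) :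
    Integrable (fun x => f x * g x) μ :=
  hf.integrable_mul hg

end SquareIntegrable

/-! ### Approximation by functions of finitely many letters -/

section Approximation

variable {S : Type*}

/-- `f` depends on the first `m` letters only. -/
def FinDep (m : ℕ) (f : (ℕ → S) → ℝ) : Prop :=
  ∀ u v : ℕ → S, (∀ j < m, u j = v j) → f u = f v

lemma FinDep.mono {m k : ℕ} {f : (ℕ → S) → ℝ} (h : FinDep m f) (hmk : m ≤ k) : FinDep k f :=
  fun u v huv => h u v fun j hj => huv j (hj.trans_le hmk)

lemma FinDep.comp_seqShift {m : ℕ} {f : (ℕ → S) → ℝ} (h : FinDep m f) (d : ℕ) :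
    FinDep (m + d) (fun v => f (seqShift d v)) :=
  fun u v huv => h _ _ fun j hj => huv (j + d) (by omega)

variable [MeasurableSpace S] {f g : (ℕ → S) → ℝ}

lemma FinDep.avg {m : ℕ} (h : FinDep m f) (ν : Measure S) : FinDep (m - 1) (avg ν f) := by
  intro u v huv
  refine integral_congr_ae (.of_forall fun s => h _ _ fun j hj => ?_)
  cases j with
  | zero => rfl
  | succ j => exact huv j (by omega)

lemma FinDep.avg_iterate {m : ℕ} (h : FinDep m f) (ν : Measure S) (k : ℕ) :
    FinDep (m - k) ((SpectralTS.avg ν)^[k] f) := by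
  induction k with
  | zero => exact h
  | succ k ih => rw [Function.iterate_succ_apply']; exact ih.avg ν

variable (ν : Measure S) [IsProbabilityMeasure ν]

lemma integral_avg_iterate (hf : Measurable f) (h2 : MemLp f 2 (seqMeasure ν)) (k : ℕ) :
    ∫ v, (avg ν)^[k] f v ∂(seqMeasure ν) = ∫ v, f v ∂(seqMeasure ν) := by
  induction k with
  | zero => rfl
  | succ k ih =>
    rw [Function.iterate_succ_apply',
      integral_avg ν ((memLp_avg_iterate ν hf h2 k).integrable one_le_two), ih]

/-- Each averaging removes one letter; once none is left the function is constant, and averaging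
preserves the mean. -/
lemma avg_iterate_eq_integral {m k : ℕ} (hf : Measurable f) (h2 : MemLp f 2 (seqMeasure ν))
    (h : FinDep m f) (hk : m ≤ k) (v : ℕ → S) :
    (avg ν)^[k] f v = ∫ u, f u ∂(seqMeasure ν) := by
  have hd := (h.mono hk).avg_iterate ν k
  rw [Nat.sub_self] at hd
  rw [← integral_avg_iterate ν hf h2 k,
    show (avg ν)^[k] f = fun _ => (avg ν)^[k] f v from funext fun u => hd u v (by simp)]
  simp

lemma iSup_piLE_eq_pi :
    (⨆ n, (Filtration.piLE (X := fun _ : ℕ => S)) n) = MeasurableSpace.pi := by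
  refine le_antisymm (iSup_le fun n => Filtration.piLE.le n) ?_
  refine iSup_le fun k => ?_
  refine le_trans ?_ (le_iSup _ k)
  rw [Filtration.piLE]
  change _ ≤ MeasurableSpace.comap _ _
  rintro _ ⟨t, ht, rfl⟩
  exact ⟨(fun u : (i : Set.Iic k) → S => u ⟨k, Set.self_mem_Iic⟩) ⁻¹' t, (measurable_pi_apply (⟨k, Set.self_mem_Iic⟩ : Set.Iic k)) ht, rfl⟩

/-- A simple function near `f` is conditioned on its first coordinates; Lévy's upward theorem and
dominated convergence give L² convergence. -/
lemma exists_bounded_finDep_lpNorm_sub_lt (h2 : MemLp f 2 (seqMeasure ν)) {δ : ℝ} (hδ : 0 < δ) :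
    ∃ (h : (ℕ → S) → ℝ) (m : ℕ) (K : ℝ), Measurable h ∧ (∀ v, |h v| ≤ K) ∧ FinDep m h ∧
      MemLp h 2 (seqMeasure ν) ∧ lpNorm (f - h) 2 (seqMeasure ν) < δ := by
  obtain ⟨g, hg, hg2⟩ := h2.exists_simpleFunc_eLpNorm_sub_lt (by simp)
    (ε := ENNReal.ofReal (δ / 2)) (by simpa using hδ)
  obtain ⟨K, hK⟩ : ∃ K : ℝ, ∀ v, |g v| ≤ K := by
    obtain ⟨K, hK⟩ := g.exists_forall_norm_le
    exact ⟨K, hK⟩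
  have hK0 : 0 ≤ K := (abs_nonneg _).trans (hK (nonempty_of_isProbabilityMeasure
    (seqMeasure ν)).some)
  -- A conditional expectation is bounded by `K` only almost everywhere. Clipping makes the bound
  -- pointwise and does not affect the limit, since `|g| ≤ K`.
  set c : ℕ → (ℕ → S) → ℝ := fun n v =>
    max (-K) (min K (((seqMeasure ν)[g | Filtration.piLE (X := fun _ : ℕ => S) n]) v)) with hc
  have hcK : ∀ n v, |c n v| ≤ K := fun n v => abs_le.2
    ⟨le_max_left _ _, max_le (by linarith) (min_le_left _ _)⟩
  have hce : ∀ n, StronglyMeasurable[Filtration.piLE (X := fun _ : ℕ => S) n]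
      ((seqMeasure ν)[g | Filtration.piLE (X := fun _ : ℕ => S) n]) :=
    fun n => stronglyMeasurable_condExp
  have hcm : ∀ n, Measurable (c n) := fun n =>
    measurable_const.max (measurable_const.min ((hce n).mono (Filtration.piLE.le n)).measurable)
  have hc2 : ∀ n, MemLp (c n) 2 (seqMeasure ν) := fun n =>
    MemLp.of_bound (hcm n).aestronglyMeasurable K (.of_forall fun v => hcK n v)
  have hlim : ∀ᵐ v ∂(seqMeasure ν), Tendsto (fun n => c n v) atTop (𝓝 (g v)) := by
    have hgi : Integrable g (seqMeasure ν) := hg2.integrable one_le_two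
    have hgm : StronglyMeasurable[⨆ n, (Filtration.piLE (X := fun _ : ℕ => S)) n] g := by
      rw [iSup_piLE_eq_pi]; exact g.stronglyMeasurable
    filter_upwards [hgi.tendsto_ae_condExp hgm] with v hv
    have h1 : Tendsto (fun n => c n v) atTop (𝓝 (max (-K) (min K (g v)))) :=
      tendsto_const_nhds.max (tendsto_const_nhds.min hv)
    rwa [min_eq_right (abs_le.1 (hK v)).2, max_eq_right (abs_le.1 (hK v)).1] at h1
  have hint : Tendsto (fun n => ∫ v, (g v - c n v) ^ 2 ∂(seqMeasure ν)) atTop (𝓝 0) := by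
    have h := tendsto_integral_of_dominated_convergence (μ := seqMeasure ν)
      (F := fun n v => (g v - c n v) ^ 2) (f := fun _ => (0 : ℝ)) (fun _ => (2 * K) ^ 2)
      (fun n => ((g.measurable.sub (hcm n)).pow_const 2).aestronglyMeasurable)
      (integrable_const _) (fun n => .of_forall fun v => ?_) ?_
    · simpa using h
    · rw [Real.norm_eq_abs, abs_pow]
      gcongr
      exact (abs_sub _ _).trans (by linarith [hK v, hcK n v])
    · filter_upwards [hlim] with v hv
      have := ((tendsto_const_nhds (x := g v)).sub hv).pow 2
      simpa using this
  obtain ⟨n, hn⟩ := (hint.eventually (gt_mem_nhds (show (0 : ℝ) < (δ / 2) ^ 2 by positivity))).exists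
  have hgc : lpNorm (⇑g - c n) 2 (seqMeasure ν) < δ / 2 := by
    rw [lpNorm_two_eq_sqrt (hg2.sub (hc2 n)), Real.sqrt_lt' (by positivity)]
    exact hn
  have hfg : lpNorm (f - ⇑g) 2 (seqMeasure ν) < δ / 2 := by
    rw [← toReal_eLpNorm (h2.sub hg2).1]
    exact (ENNReal.toReal_lt_of_lt_ofReal hg)
  -- `piLE n` sees coordinates `0, …, n`, hence `n + 1` letters.
  refine ⟨c n, n + 1, K, hcm n, hcK n, ?_, hc2 n, ?_⟩
  · intro u v huv
    have := (hce n).dependsOn_of_piLE (x := u) (y := v) (fun i hi => huv i (by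
      simp only [Set.mem_Iic] at hi; omega))
    simp only [hc, this]
  · have h3 := lpNorm_sub_le_lpNorm_sub_add_lpNorm_sub h2 hg2 (h := c n)
      (p := 2) (by norm_num)
    linarith

/-- A quantitative zero-one law. A finitely dependent approximant averages to its mean after
finitely many steps, that mean is small because `f` is centred, and averaging contracts the
approximation error. -/
lemma tendsto_lpNorm_avg_iterate (hf : Measurable f) (h2 : MemLp f 2 (seqMeasure ν))
    (h0 : ∫ v, f v ∂(seqMeasure ν) = 0) :
    Tendsto (fun k => lpNorm ((avg ν)^[k] f) 2 (seqMeasure ν)) atTop (𝓝 0) := by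
  rw [Metric.tendsto_atTop]
  intro δ hδ
  obtain ⟨h, m, K, hm, -, hfin, hh2, hlt⟩ :=
    exists_bounded_finDep_lpNorm_sub_lt ν h2 (half_pos hδ)
  refine ⟨m, fun k hk => ?_⟩
  rw [Real.dist_eq, sub_zero, abs_of_nonneg lpNorm_nonneg]
  have h1 := lpNorm_avg_iterate_sub_le ν hf hm h2 hh2 k
  have h3 : (avg ν)^[k] h = fun _ => ∫ u, h u ∂(seqMeasure ν) :=
    funext fun v => avg_iterate_eq_integral ν hm hh2 hfin hk v
  have h4 : lpNorm ((avg ν)^[k] h) 2 (seqMeasure ν) = |∫ u, h u ∂(seqMeasure ν)| := by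
    rw [h3]; simp
  have h5 : |∫ u, h u ∂(seqMeasure ν)| ≤ lpNorm (f - h) 2 (seqMeasure ν) := by
    have h6 := abs_integral_le_lpNorm_two (h2.sub hh2)
    rw [integral_sub' (h2.integrable one_le_two) (hh2.integrable one_le_two), h0, zero_sub,
      abs_neg] at h6
    exact h6
  have h7 := lpNorm_le_lpNorm_add_lpNorm_sub (f := (avg ν)^[k] f) (memLp_avg_iterate ν hm hh2 k)
    (p := 2) (by norm_num)
  rw [lpNorm_sub_comm] at h7
  linarith

end Approximation

/-! ### Martingale increments and decay of covariances -/

section Increments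

variable {S : Type*} [MeasurableSpace S] (ν : Measure S) [IsProbabilityMeasure ν]
  {f g : (ℕ → S) → ℝ}

/-- `φ` is square integrable and orthogonal to all functions of the letters after the first. -/
def IsMartDiff (φ : (ℕ → S) → ℝ) : Prop :=
  MemLp φ 2 (seqMeasure ν) ∧ ∀ g : (ℕ → S) → ℝ, MemLp g 2 (seqMeasure ν) →
    ∫ v, φ v * g (seqShift 1 v) ∂(seqMeasure ν) = 0

lemma MemLp.comp_seqShift (h : MemLp f 2 (seqMeasure ν)) (d : ℕ) :
    MemLp (fun v => f (seqShift d v)) 2 (seqMeasure ν) :=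
  h.comp_measurePreserving (measurePreserving_seqShift ν d)

lemma integral_comp_seqShift (hf : AEStronglyMeasurable f (seqMeasure ν)) (d : ℕ) :
    ∫ v, f (seqShift d v) ∂(seqMeasure ν) = ∫ v, f v ∂(seqMeasure ν) := by
  have h := measurePreserving_seqShift ν d
  have h1 := integral_map (μ := seqMeasure ν) (φ := seqShift d) (f := f)
    h.measurable.aemeasurable (by rwa [h.map_eq])
  rw [h.map_eq] at h1
  exact h1.symm

lemma measurable_incr (hf : Measurable f) : Measurable (incr ν f) :=
  hf.sub ((measurable_avg ν hf).comp (measurable_seqShift 1))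

lemma isMartDiff_incr (hf : Measurable f) (h2 : MemLp f 2 (seqMeasure ν)) :
    IsMartDiff ν (incr ν f) := by
  have ha := memLp_avg ν hf h2
  refine ⟨h2.sub (MemLp.comp_seqShift ν ha 1), fun g hg => ?_⟩
  have hg1 := MemLp.comp_seqShift ν hg 1
  simp only [incr, sub_mul]
  rw [integral_sub (integrable_mul_of_memLp_two h2 hg1) (integrable_mul_of_memLp_two (MemLp.comp_seqShift ν ha 1) hg1),
    ← integral_avg_mul ν h2 hg,
    integral_comp_seqShift ν (f := fun v => avg ν f v * g v) (ha.1.mul hg.1), sub_self]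

lemma IsMartDiff.sub {φ ψ : (ℕ → S) → ℝ} (h1 : IsMartDiff ν φ) (h2 : IsMartDiff ν ψ) :
    IsMartDiff ν (φ - ψ) := by
  refine ⟨h1.1.sub h2.1, fun g hg => ?_⟩
  have hg1 := MemLp.comp_seqShift ν hg 1
  simp only [Pi.sub_apply, sub_mul]
  rw [integral_sub (integrable_mul_of_memLp_two h1.1 hg1) (integrable_mul_of_memLp_two h2.1 hg1), h1.2 g hg, h2.2 g hg,
    sub_self]

lemma IsMartDiff.integral_eq_zero {φ : (ℕ → S) → ℝ} (h : IsMartDiff ν φ) :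
    ∫ v, φ v ∂(seqMeasure ν) = 0 := by
  simpa using h.2 (fun _ => 1) (memLp_const 1)

lemma lpNorm_incr_sub_le (hf : Measurable f) (hg : Measurable g)
    (hf2 : MemLp f 2 (seqMeasure ν)) (hg2 : MemLp g 2 (seqMeasure ν)) :
    lpNorm (incr ν f - incr ν g) 2 (seqMeasure ν) ≤ 2 * lpNorm (f - g) 2 (seqMeasure ν) := by
  have ha := (memLp_avg ν hf hf2).sub (memLp_avg ν hg hg2)
  have he : incr ν f - incr ν g =
      (f - g) - fun v => (avg ν f - avg ν g) (seqShift 1 v) := by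
    funext v; simp only [incr, Pi.sub_apply]; ring
  rw [he]
  have h1 := lpNorm_sub_le (hf2.sub hg2) (g := fun v => (avg ν f - avg ν g) (seqShift 1 v))
    (p := 2) (by norm_num)
  rw [lpNorm_comp_measurePreserving ha.1 (measurePreserving_seqShift ν 1)] at h1
  linarith [lpNorm_avg_sub_le ν hf hg hf2 hg2]

/-- The increments of the successive averages of `f`. -/
def incrIter (f : (ℕ → S) → ℝ) (j : ℕ) : (ℕ → S) → ℝ := incr ν ((avg ν)^[j] f)

lemma isMartDiff_incrIter (hf : Measurable f) (h2 : MemLp f 2 (seqMeasure ν)) (j : ℕ) :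
    IsMartDiff ν (incrIter ν f j) :=
  isMartDiff_incr ν (measurable_avg_iterate ν hf j) (memLp_avg_iterate ν hf h2 j)

/-- Polarized Pythagoras: `f` is the orthogonal sum of `incr ν f` and the shifted `avg ν f`. Along
iterates of `avg` the right side telescopes. -/
lemma integral_incr_mul_incr (hf : Measurable f) (hg : Measurable g)
    (hf2 : MemLp f 2 (seqMeasure ν)) (hg2 : MemLp g 2 (seqMeasure ν)) :
    ∫ v, incr ν f v * incr ν g v ∂(seqMeasure ν) =
      ∫ v, f v * g v ∂(seqMeasure ν) - ∫ v, avg ν f v * avg ν g v ∂(seqMeasure ν) := by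
  have hD := isMartDiff_incr ν hf hf2
  have hga := memLp_avg ν hg hg2
  have hfa := memLp_avg ν hf hf2
  have h1 : ∫ v, incr ν f v * incr ν g v ∂(seqMeasure ν) =
      ∫ v, incr ν f v * g v ∂(seqMeasure ν) := by
    have : ∀ v, incr ν f v * incr ν g v =
        incr ν f v * g v - incr ν f v * avg ν g (seqShift 1 v) := fun v => by
      simp only [incr]; ring
    simp only [this]
    rw [integral_sub (integrable_mul_of_memLp_two hD.1 hg2)
      (integrable_mul_of_memLp_two hD.1 (MemLp.comp_seqShift ν hga 1)), hD.2 _ hga, sub_zero]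
  rw [h1]
  simp only [incr, sub_mul]
  rw [integral_sub (integrable_mul_of_memLp_two hf2 hg2)
    (integrable_mul_of_memLp_two (MemLp.comp_seqShift ν hfa 1) hg2)]
  congr 1
  simp only [mul_comm (avg ν f _)]
  exact (integral_avg_mul ν hg2 hfa).symm

/-- By duality the lag `h` covariance is `c 0`, where `c i` pairs the iterates `i` and `i + h`. The
differences `c i - c (i + 1)` pair increments, and `c N` tends to `0`. -/
lemma abs_integral_mul_comp_seqShift_le (hf : Measurable f) (h2 : MemLp f 2 (seqMeasure ν))
    (h0 : ∫ v, f v ∂(seqMeasure ν) = 0)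
    (hs : Summable fun j => lpNorm (incrIter ν f j) 2 (seqMeasure ν)) (h : ℕ) :
    |∫ v, f v * f (seqShift h v) ∂(seqMeasure ν)| ≤
      ∑' i, lpNorm (incrIter ν f i) 2 (seqMeasure ν) *
        lpNorm (incrIter ν f (i + h)) 2 (seqMeasure ν) := by
  set κ := fun j => lpNorm (incrIter ν f j) 2 (seqMeasure ν) with hκ
  have hκ0 : ∀ j, 0 ≤ κ j := fun j => lpNorm_nonneg
  set A : ℕ → (ℕ → S) → ℝ := fun j => (avg ν)^[j] f with hA
  have hA2 : ∀ j, MemLp (A j) 2 (seqMeasure ν) := memLp_avg_iterate ν hf h2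
  have hsum : Summable fun i => κ i * κ (i + h) := by
    have hb : ∀ i, κ (i + h) ≤ ∑' j, κ j := fun i => hs.le_tsum (i + h) fun j _ => hκ0 j
    exact Summable.of_nonneg_of_le (fun i => mul_nonneg (hκ0 _) (hκ0 _))
      (fun i => mul_le_mul_of_nonneg_left (hb i) (hκ0 i)) (hs.mul_right _)
  set c : ℕ → ℝ := fun i => ∫ v, A i v * A (i + h) v ∂(seqMeasure ν) with hc
  have hstep : ∀ i, |c i| ≤ |c (i + 1)| + κ i * κ (i + h) := by
    intro i
    have h1 := integral_incr_mul_incr ν (measurable_avg_iterate ν hf i)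
      (measurable_avg_iterate ν hf (i + h)) (hA2 i) (hA2 (i + h))
    have h3 : ∫ v, incrIter ν f i v * incrIter ν f (i + h) v ∂(seqMeasure ν) = c i - c (i + 1) := by
      rw [incrIter, incrIter, h1]
      simp only [hc, hA]
      rw [show i + 1 + h = (i + h) + 1 by ring, Function.iterate_succ_apply',
        Function.iterate_succ_apply']
    have h4 := abs_integral_mul_le_lpNorm (isMartDiff_incrIter ν hf h2 i).1
      (isMartDiff_incrIter ν hf h2 (i + h)).1
    rw [h3] at h4
    have h5 : |c i| ≤ |c (i + 1)| + |c i - c (i + 1)| := by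
      have := abs_add_le (c (i + 1)) (c i - c (i + 1))
      simpa using this
    exact h5.trans (by gcongr)
  have hN : ∀ N, |c 0| ≤ |c N| + ∑ i ∈ Finset.range N, κ i * κ (i + h) := by
    intro N
    induction N with
    | zero => simp
    | succ N ih => rw [Finset.sum_range_succ]; linarith [hstep N]
  have hc0 : c 0 = ∫ v, f v * f (seqShift h v) ∂(seqMeasure ν) := by
    rw [← integral_avg_iterate_mul ν hf h2 h2 h]
    simp only [hc, hA, zero_add, Function.iterate_zero, id, mul_comm]
  have hclim : Tendsto (fun N => |c N|) atTop (𝓝 0) := by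
    have ht := tendsto_lpNorm_avg_iterate ν hf h2 h0
    have ht2 := ht.mul (ht.comp (tendsto_add_atTop_nat h))
    rw [mul_zero] at ht2
    exact squeeze_zero (fun _ => abs_nonneg _)
      (fun N => abs_integral_mul_le_lpNorm (hA2 N) (hA2 (N + h))) ht2
  rw [← hc0]
  have hlim := hclim.add hsum.hasSum.tendsto_sum_nat
  rw [zero_add] at hlim
  exact ge_of_tendsto' hlim hN

end Increments

/-! ### Transfer from sequence space to the process -/

section Innovations

variable {Ω S : Type*}

/-- The innovations up to time `t`, listed backwards in time. -/
def pastSeq (ε : ℤ → Ω → S) (t : ℤ) (ω : Ω) : ℕ → S := fun j => ε (t - (j : ℤ)) ω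

lemma seqShift_pastSeq (ε : ℤ → Ω → S) (t : ℤ) (d : ℕ) (ω : Ω) :
    seqShift d (pastSeq ε t ω) = pastSeq ε (t - d) ω := by
  funext j
  simp only [seqShift, pastSeq]
  congr 1
  push_cast
  ring

variable [MeasurableSpace S] {ε : ℤ → Ω → S}

lemma past_eq_comap_pastSeq (t : ℤ) :
    past ε t = MeasurableSpace.comap (pastSeq ε t) MeasurableSpace.pi := by
  simp only [MeasurableSpace.pi, MeasurableSpace.comap_iSup, MeasurableSpace.comap_comp]
  refine le_antisymm (iSup₂_le fun j hj => ?_) (iSup_le fun k => ?_)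
  · have hj' : j ≤ t := hj
    refine le_trans (le_of_eq ?_) (le_iSup _ (t - j).toNat)
    congr 1
    funext ω
    simp only [Function.comp_apply, pastSeq]
    rw [Int.toNat_of_nonneg (by omega)]
    simp
  · exact le_iSup₂_of_le (t - k) (show t - (k : ℤ) ≤ t by omega) le_rfl

variable [MeasurableSpace Ω] {μ : Measure Ω}

lemma measurable_pastSeq (hε : ∀ n, Measurable (ε n)) (t : ℤ) : Measurable (pastSeq ε t) :=
  measurable_pi_iff.2 fun j => hε (t - j)

lemma measurePreserving_pastSeq [IsProbabilityMeasure μ] (ν : Measure S) [IsProbabilityMeasure ν]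
    (hε : ∀ n, Measurable (ε n)) (hindep : iIndepFun ε μ) (hν : ∀ n, μ.map (ε n) = ν) (t : ℤ) :
    MeasurePreserving (pastSeq ε t) μ (seqMeasure ν) := by
  refine ⟨measurable_pastSeq hε t, ?_⟩
  have hinj : Function.Injective fun j : ℕ => t - (j : ℤ) := fun a b hab => by
    simpa using hab
  have h := (hindep.precomp hinj).map_fun_eq_infinitePi_map (fun j => hε _)
  simp only [hν] at h
  exact h

section Stationary

variable (ν : Measure S) [IsProbabilityMeasure ν]
  (hlaw : ∀ t, MeasurePreserving (pastSeq ε t) μ (seqMeasure ν)) {f φ : (ℕ → S) → ℝ}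

include hlaw

lemma integral_comp_pastSeq (hf : AEStronglyMeasurable f (seqMeasure ν)) (t : ℤ) :
    ∫ ω, f (pastSeq ε t ω) ∂μ = ∫ v, f v ∂(seqMeasure ν) := by
  have h1 := integral_map (μ := μ) (φ := pastSeq ε t) (f := f)
    (hlaw t).measurable.aemeasurable (by rwa [(hlaw t).map_eq])
  rw [(hlaw t).map_eq] at h1
  exact h1.symm

lemma memLp_comp_pastSeq (hf : MemLp f 2 (seqMeasure ν)) (t : ℤ) :
    MemLp (fun ω => f (pastSeq ε t ω)) 2 μ :=
  hf.comp_measurePreserving (hlaw t)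

lemma lpNorm_comp_pastSeq (hf : AEStronglyMeasurable f (seqMeasure ν)) (t : ℤ) :
    lpNorm (fun ω => f (pastSeq ε t ω)) 2 μ = lpNorm f 2 (seqMeasure ν) :=
  lpNorm_comp_measurePreserving hf (hlaw t)

lemma integral_pastSeq_mul_pastSeq (hf : MemLp f 2 (seqMeasure ν))
    (hφ : MemLp φ 2 (seqMeasure ν)) (t : ℤ) (d : ℕ) :
    ∫ ω, f (pastSeq ε t ω) * φ (pastSeq ε (t - d) ω) ∂μ =
      ∫ v, f v * φ (seqShift d v) ∂(seqMeasure ν) := by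
  rw [← integral_comp_pastSeq ν hlaw (f := fun v => f v * φ (seqShift d v))
    (hf.1.mul (MemLp.comp_seqShift ν hφ d).1) t]
  simp only [seqShift_pastSeq]

lemma integral_pastSeq_mul_pastSeq_self (hf : MemLp f 2 (seqMeasure ν)) (s t : ℤ) :
    ∫ ω, f (pastSeq ε s ω) * f (pastSeq ε t ω) ∂μ =
      ∫ v, f v * f (seqShift (s - t).natAbs v) ∂(seqMeasure ν) := by
  rcases le_total t s with h | h
  · rw [← integral_pastSeq_mul_pastSeq ν hlaw hf hf s]
    rw [show s - ((s - t).natAbs : ℤ) = t by omega]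
  · rw [← integral_pastSeq_mul_pastSeq ν hlaw hf hf t]
    rw [show t - ((s - t).natAbs : ℤ) = s by omega]
    simp only [mul_comm]

lemma IsMartDiff.integral_mul_eq_zero (hφ : IsMartDiff ν φ) {s t : ℤ} (hst : s ≠ t) :
    ∫ ω, φ (pastSeq ε s ω) * φ (pastSeq ε t ω) ∂μ = 0 := by
  rw [integral_pastSeq_mul_pastSeq_self ν hlaw hφ.1]
  obtain ⟨d, hd⟩ : ∃ d, (s - t).natAbs = d + 1 := ⟨(s - t).natAbs - 1, by omega⟩
  rw [hd]
  have := hφ.2 (fun v => φ (seqShift d v)) (MemLp.comp_seqShift ν hφ.1 d)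
  simpa only [seqShift_seqShift] using this

end Stationary

end Innovations

/-! ### Second moment of a finite sum -/

section SumOfSquares

variable {Ω ι : Type*} [MeasurableSpace Ω] {μ : Measure Ω}

lemma integral_sq_sum (s : Finset ι) {Z : ι → Ω → ℝ} (hZ : ∀ i ∈ s, MemLp (Z i) 2 μ) :
    ∫ ω, (∑ i ∈ s, Z i ω) ^ 2 ∂μ = ∑ i ∈ s, ∑ j ∈ s, ∫ ω, Z i ω * Z j ω ∂μ := by
  simp only [sq, Finset.sum_mul_sum]
  rw [integral_finsetSum _ fun i hi => integrable_finsetSum _ fun j hj =>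
    integrable_mul_of_memLp_two (hZ i hi) (hZ j hj)]
  exact Finset.sum_congr rfl fun i hi => integral_finsetSum _ fun j hj =>
    integrable_mul_of_memLp_two (hZ i hi) (hZ j hj)

end SumOfSquares

/-! ### L² bounds for weighted sums -/

section WeightedSums

variable {Ω S : Type*} [MeasurableSpace Ω] [MeasurableSpace S] {μ : Measure Ω} {ε : ℤ → Ω → S}
  (ν : Measure S) [IsProbabilityMeasure ν]
  (hlaw : ∀ t, MeasurePreserving (pastSeq ε t) μ (seqMeasure ν)) {f φ : (ℕ → S) → ℝ}

include hlaw

lemma memLp_weighted_sum (hf : MemLp f 2 (seqMeasure ν)) (n : ℕ) (w : ℕ → ℝ) (j : ℕ) :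
    MemLp (fun ω => ∑ t ∈ Finset.Icc 1 n, w t * f (pastSeq ε ((t : ℤ) - j) ω)) 2 μ :=
  memLp_finsetSum _ fun t _ => (memLp_comp_pastSeq ν hlaw hf _).const_mul (w t)

/-- Cross terms vanish by orthogonality, which is what gives `√n` in place of `n`. -/
lemma IsMartDiff.lpNorm_weighted_sum_le (hφ : IsMartDiff ν φ) (n : ℕ) (w : ℕ → ℝ) {C : ℝ}
    (hC : 0 ≤ C) (hw : ∀ t, |w t| ≤ C) (j : ℕ) :
    lpNorm (fun ω => ∑ t ∈ Finset.Icc 1 n, w t * φ (pastSeq ε ((t : ℤ) - j) ω)) 2 μ ≤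
      lpNorm φ 2 (seqMeasure ν) * (C * √n) := by
  refine le_of_sq_le_sq ?_ (mul_nonneg lpNorm_nonneg (by positivity))
  rw [lpNorm_two_sq (memLp_weighted_sum ν hlaw hφ.1 n w j),
    integral_sq_sum (Z := fun (t : ℕ) ω => w t * φ (pastSeq ε ((t : ℤ) - j) ω)) _
      fun t _ => (memLp_comp_pastSeq ν hlaw hφ.1 ((t : ℤ) - j)).const_mul (w t)]
  have hterm : ∀ s ∈ Finset.Icc 1 n, ∑ t ∈ Finset.Icc 1 n,
      ∫ ω, w s * φ (pastSeq ε ((s : ℤ) - j) ω) * (w t * φ (pastSeq ε ((t : ℤ) - j) ω)) ∂μ ≤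
      C ^ 2 * lpNorm φ 2 (seqMeasure ν) ^ 2 := by
    intro s hs
    rw [Finset.sum_eq_single_of_mem s hs]
    · have : ∀ ω, w s * φ (pastSeq ε ((s : ℤ) - j) ω) * (w s * φ (pastSeq ε ((s : ℤ) - j) ω)) =
          w s ^ 2 * (φ (pastSeq ε ((s : ℤ) - j) ω)) ^ 2 := fun ω => by ring
      simp only [this]
      rw [integral_const_mul, lpNorm_two_sq hφ.1,
        integral_comp_pastSeq ν hlaw (f := fun v => φ v ^ 2) (hφ.1.1.pow 2)]
      refine mul_le_mul_of_nonneg_right ?_ (integral_nonneg fun _ => sq_nonneg _)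
      rw [← sq_abs]
      exact pow_le_pow_left₀ (abs_nonneg _) (hw s) 2
    · intro t _ hts
      have : ∀ ω, w s * φ (pastSeq ε ((s : ℤ) - j) ω) * (w t * φ (pastSeq ε ((t : ℤ) - j) ω)) =
          w s * w t * (φ (pastSeq ε ((s : ℤ) - j) ω) * φ (pastSeq ε ((t : ℤ) - j) ω)) :=
        fun ω => by ring
      simp only [this]
      rw [integral_const_mul, hφ.integral_mul_eq_zero ν hlaw (by simpa using hts.symm), mul_zero]
  refine (Finset.sum_le_sum hterm).trans (le_of_eq ?_)
  rw [Finset.sum_const, Nat.card_Icc, nsmul_eq_mul, mul_pow, mul_pow, Real.sq_sqrt (by positivity)]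
  simp
  ring

/-- The triangle inequality. The factor `n` is harmless: the bound serves for a remainder that is
sent to `0` with `n` fixed. -/
lemma lpNorm_weighted_sum_le (hf : MemLp f 2 (seqMeasure ν)) (n : ℕ) (w : ℕ → ℝ) {C : ℝ}
    (hw : ∀ t, |w t| ≤ C) (j : ℕ) :
    lpNorm (fun ω => ∑ t ∈ Finset.Icc 1 n, w t * f (pastSeq ε ((t : ℤ) - j) ω)) 2 μ ≤
      n * C * lpNorm f 2 (seqMeasure ν) := by
  have h := lpNorm_sum_le (s := Finset.Icc 1 n) (p := 2) (μ := μ)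
    (f := fun t ω => w t * f (pastSeq ε ((t : ℤ) - j) ω))
    (fun t _ => (memLp_comp_pastSeq ν hlaw hf _).const_mul (w t)) (by norm_num)
  have he : (fun ω => ∑ t ∈ Finset.Icc 1 n, w t * f (pastSeq ε ((t : ℤ) - j) ω)) =
      ∑ t ∈ Finset.Icc 1 n, fun ω => w t * f (pastSeq ε ((t : ℤ) - j) ω) := by
    funext ω; simp
  rw [he]
  refine h.trans ?_
  have hb : ∀ t ∈ Finset.Icc 1 n, lpNorm (fun ω => w t * f (pastSeq ε ((t : ℤ) - j) ω)) 2 μ ≤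
      C * lpNorm f 2 (seqMeasure ν) := by
    intro t _
    have h1 := lpNorm_const_smul (w t) (fun ω => f (pastSeq ε ((t : ℤ) - j) ω)) (p := 2) μ
    rw [lpNorm_comp_pastSeq ν hlaw hf.1] at h1
    change lpNorm (w t • fun ω => f (pastSeq ε ((t : ℤ) - j) ω)) 2 μ ≤ _
    rw [h1]
    exact mul_le_mul_of_nonneg_right (hw t) lpNorm_nonneg
  refine (Finset.sum_le_sum hb).trans (le_of_eq ?_)
  simp [mul_assoc]

end WeightedSums

/-! ### Finitely dependent approximation, uniform in the weights -/

section FiniteApproximation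

variable {S : Type*}

lemma FinDep.sum {m : ℕ → ℕ} {F : ℕ → (ℕ → S) → ℝ} (M : ℕ) (h : ∀ j, FinDep (m j) (F j)) :
    FinDep (∑ j ∈ Finset.range M, m j) (fun v => ∑ j ∈ Finset.range M, F j v) :=
  fun u v huv => Finset.sum_congr rfl fun j hj => h j u v fun i hi => huv i
    (hi.trans_le (Finset.single_le_sum (f := m) (fun _ _ => Nat.zero_le _) hj))

variable [MeasurableSpace S] (ν : Measure S) {f : (ℕ → S) → ℝ}

/-- Martingale decomposition: the contributions of letters `0, …, J - 1`, plus the part that depends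
on older letters only. -/
lemma eq_sum_incrIter_add (J : ℕ) (v : ℕ → S) :
    f v = ∑ j ∈ Finset.range J, incrIter ν f j (seqShift j v) + (avg ν)^[J] f (seqShift J v) := by
  induction J with
  | zero => simp
  | succ J ih =>
    rw [Finset.sum_range_succ, incrIter, incr, Function.iterate_succ_apply', seqShift_seqShift,
      add_comm 1 J]
    linarith

lemma FinDep.incr {m : ℕ} (h : FinDep m f) : FinDep (m + 1) (incr ν f) := by
  intro u v huv
  simp only [SpectralTS.incr]
  rw [h u v fun j hj => huv j (by omega),
    (h.avg ν) (seqShift 1 u) (seqShift 1 v) fun j hj => huv (j + 1) (by omega)]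

lemma abs_incr_le [IsProbabilityMeasure ν] {K : ℝ} (h : ∀ v, |f v| ≤ K) (v : ℕ → S) :
    |incr ν f v| ≤ 2 * K := by
  have h1 : |avg ν f (seqShift 1 v)| ≤ K := by
    have := norm_integral_le_of_norm_le_const (μ := ν) (f := fun s => f (seqCons s (seqShift 1 v)))
      (C := K) (.of_forall fun s => h _)
    simpa [avg] using this
  have h2 := abs_sub (f v) (avg ν f (seqShift 1 v))
  rw [incr]
  linarith [h v]

variable {Ω : Type*} [MeasurableSpace Ω] {μ : Measure Ω} {ε : ℤ → Ω → S} [IsProbabilityMeasure ν]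

lemma lpNorm_weighted_sum_le_of_decomposition
    (hlaw : ∀ t, MeasurePreserving (pastSeq ε t) μ (seqMeasure ν)) {g R : (ℕ → S) → ℝ}
    {ψ : ℕ → (ℕ → S) → ℝ} (hψ : ∀ j, IsMartDiff ν (ψ j)) (hR : MemLp R 2 (seqMeasure ν)) (N : ℕ)
    (hg : ∀ v, g v = ∑ j ∈ Finset.range N, ψ j (seqShift j v) + R (seqShift N v))
    (n : ℕ) (w : ℕ → ℝ) {C : ℝ} (hC : 0 ≤ C) (hw : ∀ t, |w t| ≤ C) :
    lpNorm (fun ω => ∑ t ∈ Finset.Icc 1 n, w t * g (pastSeq ε (t : ℤ) ω)) 2 μ ≤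
      (∑ j ∈ Finset.range N, lpNorm (ψ j) 2 (seqMeasure ν)) * (C * √n) +
        n * C * lpNorm R 2 (seqMeasure ν) := by
  obtain ⟨Z, hZ⟩ : ∃ Z : ℕ → Ω → ℝ, Z = fun j ω => ∑ t ∈ Finset.Icc 1 n,
    w t * ψ j (pastSeq ε ((t : ℤ) - j) ω) := ⟨_, rfl⟩
  have he : (fun ω => ∑ t ∈ Finset.Icc 1 n, w t * g (pastSeq ε (t : ℤ) ω)) =
      (∑ j ∈ Finset.range N, Z j) +
      fun ω => ∑ t ∈ Finset.Icc 1 n, w t * R (pastSeq ε ((t : ℤ) - N) ω) := by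
    funext ω
    simp only [Pi.add_apply, Finset.sum_apply, hZ]
    rw [Finset.sum_comm, ← Finset.sum_add_distrib]
    refine Finset.sum_congr rfl fun t _ => ?_
    rw [hg, mul_add, Finset.mul_sum]
    simp only [seqShift_pastSeq]
  have hmem : ∀ j ∈ Finset.range N, MemLp (Z j) 2 μ := fun j _ => by
    rw [hZ]; exact memLp_weighted_sum ν hlaw (hψ j).1 n w j
  have hb : ∀ j ∈ Finset.range N, lpNorm (Z j) 2 μ ≤
      lpNorm (ψ j) 2 (seqMeasure ν) * (C * √n) := fun j _ => by
    rw [hZ]; exact (hψ j).lpNorm_weighted_sum_le ν hlaw n w hC hw j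
  have hsum : MemLp (∑ j ∈ Finset.range N, Z j) 2 μ := memLp_finsetSum' _ hmem
  have htri := lpNorm_add_le hsum one_le_two (g := fun ω => ∑ t ∈ Finset.Icc 1 n,
    w t * R (pastSeq ε ((t : ℤ) - N) ω))
  rw [← he] at htri
  refine htri.trans (add_le_add ?_ ?_)
  · refine (lpNorm_sum_le hmem one_le_two).trans ?_
    rw [Finset.sum_mul]
    exact Finset.sum_le_sum hb
  · exact lpNorm_weighted_sum_le ν hlaw hR n w hw _

/-- A causal process with summable projections is approximated, uniformly over weighted sums, by
bounded centred functions of finitely many innovations. -/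
theorem exists_finDep_approx (hlaw : ∀ t, MeasurePreserving (pastSeq ε t) μ (seqMeasure ν))
    (hf : Measurable f) (h2 : MemLp f 2 (seqMeasure ν))
    (h0 : ∫ v, f v ∂(seqMeasure ν) = 0)
    (hs : Summable fun j => lpNorm (incrIter ν f j) 2 (seqMeasure ν)) {η : ℝ} (hη : 0 < η) :
    ∃ (y : (ℕ → S) → ℝ) (m : ℕ) (K : ℝ), Measurable y ∧ (∀ v, |y v| ≤ K) ∧ FinDep m y ∧
      MemLp y 2 (seqMeasure ν) ∧ ∫ v, y v ∂(seqMeasure ν) = 0 ∧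
      ∀ (n : ℕ) (w : ℕ → ℝ) (C : ℝ), 0 ≤ C → (∀ t, |w t| ≤ C) →
        lpNorm (fun ω => ∑ t ∈ Finset.Icc 1 n,
          w t * (f (pastSeq ε (t : ℤ) ω) - y (pastSeq ε (t : ℤ) ω))) 2 μ ≤ η * (C * √n) := by
  set κ : ℕ → ℝ := fun j => lpNorm (incrIter ν f j) 2 (seqMeasure ν) with hκ
  -- The budget `η` is halved: the tail of the norms beyond `M` costs at most `η / 2`. The first `M`
  -- increments are approximated at cost `2 δ` each, also `η / 2` in total; `M + 1` in `δ` covers `M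
  -- = 0`.
  obtain ⟨M, hM⟩ : ∃ M, ∑' j, κ (j + M) < η / 2 :=
    ((tendsto_sum_nat_add κ).eventually (gt_mem_nhds (half_pos hη))).exists
  set δ : ℝ := η / (4 * (M + 1)) with hδ
  have hδ0 : 0 < δ := by positivity
  choose h m K hm hK hfin hh2 hlt using fun j =>
    exists_bounded_finDep_lpNorm_sub_lt ν (memLp_avg_iterate ν hf h2 j) hδ0
  have hdm : ∀ j, IsMartDiff ν (incr ν (h j)) := fun j => isMartDiff_incr ν (hm j) (hh2 j)
  -- Taking increments of the approximants keeps each term orthogonal to its strict past, so `f - y`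
  -- has a martingale decomposition of its own, with terms `ψ j`.
  set y : (ℕ → S) → ℝ := fun v => ∑ j ∈ Finset.range M, incr ν (h j) (seqShift j v) with hy
  have hy2 : MemLp y 2 (seqMeasure ν) :=
    memLp_finsetSum _ fun j _ => MemLp.comp_seqShift ν (hdm j).1 j
  set ψ : ℕ → (ℕ → S) → ℝ := fun j =>
    if j < M then incrIter ν f j - incr ν (h j) else incrIter ν f j with hψ
  have hψm : ∀ j, IsMartDiff ν (ψ j) := by
    intro j
    simp only [hψ]
    split_ifs
    · exact (isMartDiff_incrIter ν hf h2 j).sub ν (hdm j)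
    · exact isMartDiff_incrIter ν hf h2 j
  have hψn : ∀ i, ∑ j ∈ Finset.range (M + i), lpNorm (ψ j) 2 (seqMeasure ν) ≤ η := by
    intro i
    rw [Finset.sum_range_add]
    have h1 : ∑ j ∈ Finset.range M, lpNorm (ψ j) 2 (seqMeasure ν) ≤ M * (2 * δ) := by
      rw [← nsmul_eq_mul]
      refine (Finset.sum_le_card_nsmul _ _ _ fun j hj => ?_).trans (by rw [Finset.card_range])
      simp only [hψ, if_pos (Finset.mem_range.1 hj)]
      exact (lpNorm_incr_sub_le ν (measurable_avg_iterate ν hf j) (hm j)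
        (memLp_avg_iterate ν hf h2 j) (hh2 j)).trans (by linarith [hlt j])
    have h3 : ∑ j ∈ Finset.range i, lpNorm (ψ (M + j)) 2 (seqMeasure ν) ≤ ∑' j, κ (j + M) := by
      have : ∀ j, lpNorm (ψ (M + j)) 2 (seqMeasure ν) = κ (j + M) := fun j => by
        simp only [hψ, hκ]; rw [if_neg (by omega), add_comm]
      simp only [this]
      exact ((summable_nat_add_iff M).2 hs).sum_le_tsum _ fun _ _ => lpNorm_nonneg
    have h4 : M * (2 * δ) ≤ η / 2 := by
      rw [hδ, show (M : ℝ) * (2 * (η / (4 * (M + 1)))) = η / 2 * (M / (M + 1)) by field_simp; ring]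
      have : (M : ℝ) / (M + 1) ≤ 1 := by rw [div_le_one (by positivity)]; linarith
      nlinarith
    linarith
  have hdecomp : ∀ i v, f v - y v = ∑ j ∈ Finset.range (M + i), ψ j (seqShift j v) +
      (avg ν)^[M + i] f (seqShift (M + i) v) := by
    intro i v
    rw [eq_sum_incrIter_add ν (f := f) (M + i) v, Finset.sum_range_add, Finset.sum_range_add]
    have h1 : ∑ j ∈ Finset.range M, ψ j (seqShift j v) =
        ∑ j ∈ Finset.range M, incrIter ν f j (seqShift j v) - y v := by
      rw [hy, ← Finset.sum_sub_distrib]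
      refine Finset.sum_congr rfl fun j hj => ?_
      simp only [hψ, if_pos (Finset.mem_range.1 hj), Pi.sub_apply]
    have h3 : ∑ j ∈ Finset.range i, ψ (M + j) (seqShift (M + j) v) =
        ∑ j ∈ Finset.range i, incrIter ν f (M + j) (seqShift (M + j) v) :=
      Finset.sum_congr rfl fun j _ => by simp only [hψ]; rw [if_neg (by omega)]
    rw [h1, h3]
    ring
  clear_value ψ
  refine ⟨y, ∑ j ∈ Finset.range M, (m j + 1 + j), ∑ j ∈ Finset.range M, 2 * K j, ?_, ?_, ?_, hy2,
    ?_, ?_⟩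
  · exact Finset.measurable_fun_sum _ fun j _ =>
      (measurable_incr ν (hm j)).comp (measurable_seqShift j)
  · intro v
    refine (Finset.abs_sum_le_sum_abs _ _).trans (Finset.sum_le_sum fun j _ => ?_)
    exact abs_incr_le ν (hK j) _
  · exact FinDep.sum M fun j => ((hfin j).incr ν).comp_seqShift j
  · rw [hy, integral_finsetSum _ fun j _ =>
      (MemLp.comp_seqShift ν (hdm j).1 j).integrable one_le_two]
    refine Finset.sum_eq_zero fun j _ => ?_
    rw [integral_comp_seqShift ν (hdm j).1.1, (hdm j).integral_eq_zero]
  · intro n w C hC hw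
    -- With `n` fixed, the decomposition depth `M + i` goes to infinity and the remainder
    -- disappears.
    have hbound : ∀ i, lpNorm (fun ω => ∑ t ∈ Finset.Icc 1 n,
        w t * (f (pastSeq ε (t : ℤ) ω) - y (pastSeq ε (t : ℤ) ω))) 2 μ ≤
        η * (C * √n) + n * C * lpNorm ((avg ν)^[M + i] f) 2 (seqMeasure ν) := by
      intro i
      refine (lpNorm_weighted_sum_le_of_decomposition ν hlaw hψm
        (memLp_avg_iterate ν hf h2 (M + i)) (M + i) (g := fun v => f v - y v) (hdecomp i)
        n w hC hw).trans ?_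
      exact add_le_add_left (mul_le_mul_of_nonneg_right (hψn i) (by positivity)) _
    have hlim : Tendsto (fun i => η * (C * √n) +
        n * C * lpNorm ((avg ν)^[M + i] f) 2 (seqMeasure ν)) atTop (𝓝 (η * (C * √n))) := by
      have h1 := (tendsto_lpNorm_avg_iterate ν hf h2 h0).comp (tendsto_add_atTop_nat M)
      have h3 := (h1.const_mul (n * C)).const_add (η * (C * √n))
      simpa [Function.comp_def, add_comm M] using h3
    exact ge_of_tendsto' hlim hbound

end FiniteApproximation

/-! ### Conditional expectations, projections and summable covariances -/

section Projections

variable {Ω S : Type*} [MeasurableSpace Ω] [MeasurableSpace S] {μ : Measure Ω}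
  [IsProbabilityMeasure μ] {ε : ℤ → Ω → S}
  (ν : Measure S) [IsProbabilityMeasure ν]
  (hlaw : ∀ t, MeasurePreserving (pastSeq ε t) μ (seqMeasure ν)) {f : (ℕ → S) → ℝ}

include hlaw

/-- Tested against the indicator of an event of the past, this is the duality between iterated
averaging and the shift. -/
lemma condExp_past (hf : Measurable f) (h2 : MemLp f 2 (seqMeasure ν)) (t : ℤ) (k : ℕ) :
    μ[fun ω => f (pastSeq ε t ω) | past ε (t - k)] =ᵐ[μ]
      fun ω => (avg ν)^[k] f (pastSeq ε (t - k) ω) := by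
  have hle : past ε (t - k) ≤ (inferInstance : MeasurableSpace Ω) := by
    rw [past_eq_comap_pastSeq]; exact (hlaw _).measurable.comap_le
  have hA2 := memLp_avg_iterate ν hf h2 k
  symm
  refine ae_eq_condExp_of_forall_setIntegral_eq hle
    ((memLp_comp_pastSeq ν hlaw h2 t).integrable one_le_two)
    (fun s _ _ => ((memLp_comp_pastSeq ν hlaw hA2 _).integrable one_le_two).integrableOn)
    ?_ ?_
  · intro s hs _
    rw [past_eq_comap_pastSeq] at hs
    obtain ⟨B, hB, rfl⟩ := hs
    have hg2 : MemLp (B.indicator fun _ => (1 : ℝ)) 2 (seqMeasure ν) :=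
      (memLp_const (1 : ℝ)).indicator hB
    have hpre := (hlaw (t - k)).measurable hB
    rw [← integral_indicator hpre, ← integral_indicator hpre]
    have e1 : ∀ ω, (pastSeq ε (t - k) ⁻¹' B).indicator
        (fun ω => (avg ν)^[k] f (pastSeq ε (t - k) ω)) ω =
        (avg ν)^[k] f (pastSeq ε (t - k) ω) *
          B.indicator (fun _ => (1 : ℝ)) (pastSeq ε (t - k) ω) := fun ω => by
      by_cases h : pastSeq ε (t - k) ω ∈ B <;> simp [Set.indicator, h]
    have e2 : ∀ ω, (pastSeq ε (t - k) ⁻¹' B).indicator (fun ω => f (pastSeq ε t ω)) ω =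
        f (pastSeq ε t ω) * B.indicator (fun _ => (1 : ℝ)) (pastSeq ε (t - k) ω) := fun ω => by
      by_cases h : pastSeq ε (t - k) ω ∈ B <;> simp [Set.indicator, h]
    simp only [e1, e2]
    rw [integral_pastSeq_mul_pastSeq ν hlaw h2 hg2, ← integral_avg_iterate_mul ν hf h2 hg2]
    exact integral_comp_pastSeq ν hlaw
      (f := fun v => (avg ν)^[k] f v * B.indicator (fun _ => (1 : ℝ)) v) (hA2.1.mul hg2.1) _
  · refine (Measurable.stronglyMeasurable ?_).aestronglyMeasurable
    rw [past_eq_comap_pastSeq]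
    exact (measurable_avg_iterate ν hf k).comp (comap_measurable _)

lemma proj_zero_ae (hf : Measurable f) (h2 : MemLp f 2 (seqMeasure ν)) (k : ℕ) :
    proj μ ε 0 (fun ω => f (pastSeq ε (k : ℤ) ω)) =ᵐ[μ]
      fun ω => incrIter ν f k (pastSeq ε 0 ω) := by
  have h1 := condExp_past ν hlaw hf h2 (k : ℤ) k
  have h3 := condExp_past ν hlaw hf h2 (k : ℤ) (k + 1)
  rw [sub_self] at h1
  rw [show (k : ℤ) - ((k + 1 : ℕ) : ℤ) = 0 - 1 by push_cast; ring] at h3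
  filter_upwards [h1, h3] with ω e1 e3
  rw [proj, Pi.sub_apply, e1, e3, incrIter, incr, Function.iterate_succ_apply', seqShift_pastSeq]
  simp

lemma summable_lpNorm_incrIter (hf : Measurable f) (h2 : MemLp f 2 (seqMeasure ν))
    (h : ∑' k : ℕ, eLpNorm (proj μ ε 0 (fun ω => f (pastSeq ε (k : ℤ) ω))) 2 μ < ∞) :
    Summable fun j => lpNorm (incrIter ν f j) 2 (seqMeasure ν) := by
  refine (ENNReal.summable_toReal h.ne).congr fun k => ?_
  have hD := (isMartDiff_incrIter ν hf h2 k).1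
  rw [eLpNorm_congr_ae (proj_zero_ae ν hlaw hf h2 k), ← lpNorm_comp_pastSeq ν hlaw hD.1 0]
  exact toReal_eLpNorm (memLp_comp_pastSeq ν hlaw hD 0).1

omit [IsProbabilityMeasure μ] in
lemma integral_pastSeq_mul_eq_cov (h2 : MemLp f 2 (seqMeasure ν)) (s t : ℤ) :
    ∫ ω, f (pastSeq ε s ω) * f (pastSeq ε t ω) ∂μ =
      cov μ (fun n ω => f (pastSeq ε n ω)) (s - t) := by
  rw [cov, integral_pastSeq_mul_pastSeq_self ν hlaw h2, integral_pastSeq_mul_pastSeq_self ν hlaw h2,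
    zero_sub, Int.natAbs_neg]

omit [IsProbabilityMeasure μ] in
lemma cov_neg (h2 : MemLp f 2 (seqMeasure ν)) (k : ℤ) :
    cov μ (fun n ω => f (pastSeq ε n ω)) (-k) = cov μ (fun n ω => f (pastSeq ε n ω)) k := by
  simp only [cov, integral_pastSeq_mul_pastSeq_self ν hlaw h2]
  simp

omit [IsProbabilityMeasure μ] in
lemma summable_abs_cov (hf : Measurable f) (h2 : MemLp f 2 (seqMeasure ν))
    (h0 : ∫ v, f v ∂(seqMeasure ν) = 0)
    (hs : Summable fun j => lpNorm (incrIter ν f j) 2 (seqMeasure ν)) :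
    Summable fun k : ℤ => |cov μ (fun n ω => f (pastSeq ε n ω)) k| := by
  set κ := fun j => lpNorm (incrIter ν f j) 2 (seqMeasure ν) with hκ
  have hκ0 : ∀ j, 0 ≤ κ j := fun j => lpNorm_nonneg
  have hprod : Summable fun p : ℕ × ℕ => κ p.1 * κ p.2 :=
    hs.mul_of_nonneg hs hκ0 hκ0
  -- The bounds `∑ i, κ i * κ (i + h)`, summed over `h`, run over a subfamily of the product series
  -- `κ a * κ b`.
  have hinj : Function.Injective fun p : ℕ × ℕ => (p.2, p.2 + p.1) := by
    rintro ⟨a, b⟩ ⟨c, d⟩ h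
    simp only [Prod.mk.injEq] at h ⊢
    omega
  have hnat : Summable fun h : ℕ => |cov μ (fun n ω => f (pastSeq ε n ω)) (h : ℤ)| := by
    refine Summable.of_nonneg_of_le (fun _ => abs_nonneg _) (fun h => ?_)
      (hprod.comp_injective hinj).prod
    have := abs_integral_mul_comp_seqShift_le ν hf h2 h0 hs h
    rw [cov, integral_pastSeq_mul_pastSeq_self ν hlaw h2]
    simpa using this
  refine Summable.of_nat_of_neg hnat ?_
  simpa only [cov_neg ν hlaw h2] using hnat

end Projections

/-! ### Characteristic functions under local dependence -/

section LocalDependence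

/-- The point `exp (i x)` of the unit circle. -/
def phase (x : ℝ) : ℂ := Complex.exp (Complex.I * x)

@[simp] lemma norm_phase (x : ℝ) : ‖phase x‖ = 1 := Complex.norm_exp_I_mul_ofReal x

lemma phase_add (x y : ℝ) : phase (x + y) = phase x * phase y := by
  simp only [phase]
  rw [← Complex.exp_add]
  push_cast
  ring_nf

@[simp] lemma phase_zero : phase 0 = 1 := by simp [phase]

lemma continuous_phase : Continuous phase := by unfold phase; fun_prop

@[fun_prop] lemma measurable_phase : Measurable phase := continuous_phase.measurable

lemma norm_phase_sub_one_le (x : ℝ) : ‖phase x - 1‖ ≤ |x| :=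
  Real.norm_exp_I_mul_ofReal_sub_one_le

lemma norm_phase_sub_le (x y : ℝ) : ‖phase x - phase y‖ ≤ |x - y| := by
  have h : phase x - phase y = phase y * (phase (x - y) - 1) := by
    rw [mul_sub, ← phase_add]; simp
  rw [h, norm_mul, norm_phase, one_mul]
  exact norm_phase_sub_one_le _

lemma norm_phase_sub_one_sub_le (x : ℝ) : ‖phase x - 1 - Complex.I * x‖ ≤ 2 * x ^ 2 := by
  rcases le_total |x| 1 with h | h
  · have h1 : ‖Complex.I * (x : ℂ)‖ = |x| := by simp
    have := Complex.norm_exp_sub_one_sub_id_le (x := Complex.I * x) (by rwa [h1])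
    rw [h1, sq_abs] at this
    exact this.trans (by nlinarith [sq_nonneg x])
  · have h1 := norm_sub_le (phase x - 1) (Complex.I * x)
    have h2 := norm_phase_sub_one_le x
    have h3 : ‖Complex.I * (x : ℂ)‖ = |x| := by simp
    rw [h3] at h1
    nlinarith [sq_abs x]

variable {Ω : Type*} [MeasurableSpace Ω] {μ : Measure Ω}

lemma integrable_mul_phase [IsFiniteMeasure μ] {X F : Ω → ℝ} {B : ℝ} (hX : Measurable X)
    (hF : Measurable F) (hB : ∀ ω, |X ω| ≤ B) :
    Integrable (fun ω => (X ω : ℂ) * phase (F ω)) μ := by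
  refine Integrable.of_bound (Measurable.aestronglyMeasurable (by fun_prop)) B
    (.of_forall fun ω => ?_)
  simpa using hB ω

lemma integrable_phase [IsFiniteMeasure μ] {F : Ω → ℝ} (hF : Measurable F) :
    Integrable (fun ω => phase (F ω)) μ :=
  Integrable.of_bound (Measurable.aestronglyMeasurable (by fun_prop)) 1 (.of_forall fun ω => by simp)

lemma IndepFun.integral_mul_phase {X F : Ω → ℝ} (h : IndepFun X F μ) (hX : Measurable X)
    (hF : Measurable F) (u : ℝ) :
    ∫ ω, (X ω : ℂ) * phase (u * F ω) ∂μ = ((∫ ω, X ω ∂μ : ℝ) : ℂ) * ∫ ω, phase (u * F ω) ∂μ := by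
  have h1 : IndepFun (fun ω => (X ω : ℂ)) (fun ω => phase (u * F ω)) μ :=
    h.comp (φ := fun x : ℝ => (x : ℂ)) (ψ := fun x => phase (u * x)) (by fun_prop) (by fun_prop)
  rw [h1.integral_fun_mul_eq_mul_integral (Measurable.aestronglyMeasurable (by fun_prop))
    (Measurable.aestronglyMeasurable (by fun_prop)), integral_complex_ofReal]

/-- Here `X` is one summand, `W` its neighbourhood sum, `F` the rest, and `F'` the part far from the
whole neighbourhood. Expanding in `W`, the zeroth order term vanishes by independence and centring.
In the first order term `F` is replaced by `F'`, the factor `X W` is decoupled, and `F'` is replaced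
by `F + W`. The constant is `5 = 2 + 2 + 1`: Taylor remainder, first replacement (as `|F - F'| ≤
2L`), second replacement. -/
lemma norm_integral_mul_phase_add_le [IsProbabilityMeasure μ] {X W F F' : Ω → ℝ} {B L : ℝ}
    (hX : Measurable X) (hW : Measurable W) (hF : Measurable F) (hF' : Measurable F')
    (hB : ∀ ω, |X ω| ≤ B) (hL : ∀ ω, |W ω| ≤ L) (hL' : ∀ ω, |F ω + W ω - F' ω| ≤ L)
    (h0 : ∫ ω, X ω ∂μ = 0) (hXF : IndepFun X F μ) (u : ℝ)
    (hXW : ∫ ω, ((X ω * W ω : ℝ) : ℂ) * phase (u * F' ω) ∂μ =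
      ((∫ ω, X ω * W ω ∂μ : ℝ) : ℂ) * ∫ ω, phase (u * F' ω) ∂μ) :
    ‖Complex.I * ∫ ω, (X ω : ℂ) * phase (u * (F ω + W ω)) ∂μ +
      u * ((∫ ω, X ω * W ω ∂μ : ℝ) : ℂ) * ∫ ω, phase (u * (F ω + W ω)) ∂μ‖ ≤
      5 * u ^ 2 * B * L ^ 2 := by
  obtain ⟨ω₀⟩ := nonempty_of_isProbabilityMeasure μ
  have hB0 : 0 ≤ B := (abs_nonneg _).trans (hB ω₀)
  have hL0 : 0 ≤ L := (abs_nonneg _).trans (hL ω₀)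
  have hXWb : ∀ ω, |X ω * W ω| ≤ B * L := fun ω => by
    rw [abs_mul]; exact mul_le_mul (hB ω) (hL ω) (abs_nonneg _) hB0
  set c : ℝ := ∫ ω, X ω * W ω ∂μ with hc
  have hcb : |c| ≤ B * L := by
    have := norm_integral_le_of_norm_le_const (μ := μ) (f := fun ω => X ω * W ω) (C := B * L)
      (.of_forall hXWb)
    simpa using this
  have hXWm : Measurable fun ω => X ω * W ω := hX.mul hW
  have i1 : Integrable (fun ω => (X ω : ℂ) * phase (u * (F ω + W ω))) μ :=
    integrable_mul_phase hX (by fun_prop) hB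
  have i2 : Integrable (fun ω => (X ω : ℂ) * phase (u * F ω)) μ :=
    integrable_mul_phase hX (by fun_prop) hB
  have i3 : Integrable (fun ω => ((X ω * W ω : ℝ) : ℂ) * phase (u * F ω)) μ :=
    integrable_mul_phase hXWm (by fun_prop) hXWb
  have i4 : Integrable (fun ω => ((X ω * W ω : ℝ) : ℂ) * phase (u * F' ω)) μ :=
    integrable_mul_phase hXWm (by fun_prop) hXWb
  have i5 : Integrable (fun ω => phase (u * (F ω + W ω))) μ := integrable_phase (by fun_prop)
  have i6 : Integrable (fun ω => phase (u * F' ω)) μ := integrable_phase (by fun_prop)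
  have hzero : ∫ ω, (X ω : ℂ) * phase (u * F ω) ∂μ = 0 := by
    rw [IndepFun.integral_mul_phase hXF hX hF, h0]; simp
  have key : Complex.I * ∫ ω, (X ω : ℂ) * phase (u * (F ω + W ω)) ∂μ +
      u * (c : ℂ) * ∫ ω, phase (u * (F ω + W ω)) ∂μ =
      ∫ ω, (Complex.I * ((X ω : ℂ) * phase (u * (F ω + W ω)) - (X ω : ℂ) * phase (u * F ω)) +
        u * (((X ω * W ω : ℝ) : ℂ) * phase (u * F ω))) -
        u * (((X ω * W ω : ℝ) : ℂ) * phase (u * F ω) -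
          ((X ω * W ω : ℝ) : ℂ) * phase (u * F' ω)) +
        u * c * (phase (u * (F ω + W ω)) - phase (u * F' ω)) ∂μ := by
    have j1 : Integrable (fun ω => Complex.I * ((X ω : ℂ) * phase (u * (F ω + W ω)) -
        (X ω : ℂ) * phase (u * F ω))) μ := (i1.sub i2).const_mul _
    have j2 : Integrable (fun ω => (u : ℂ) * (((X ω * W ω : ℝ) : ℂ) * phase (u * F ω))) μ :=
      i3.const_mul _
    have j12 : Integrable (fun ω => Complex.I * ((X ω : ℂ) * phase (u * (F ω + W ω)) -
        (X ω : ℂ) * phase (u * F ω)) + (u : ℂ) * (((X ω * W ω : ℝ) : ℂ) * phase (u * F ω))) μ :=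
      j1.add j2
    have j3 : Integrable (fun ω => (u : ℂ) * (((X ω * W ω : ℝ) : ℂ) * phase (u * F ω) -
        ((X ω * W ω : ℝ) : ℂ) * phase (u * F' ω))) μ := (i3.sub i4).const_mul _
    have j123 : Integrable (fun ω => Complex.I * ((X ω : ℂ) * phase (u * (F ω + W ω)) -
        (X ω : ℂ) * phase (u * F ω)) + (u : ℂ) * (((X ω * W ω : ℝ) : ℂ) * phase (u * F ω)) -
        (u : ℂ) * (((X ω * W ω : ℝ) : ℂ) * phase (u * F ω) -
        ((X ω * W ω : ℝ) : ℂ) * phase (u * F' ω))) μ := j12.sub j3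
    have j4 : Integrable (fun ω => (u : ℂ) * c *
        (phase (u * (F ω + W ω)) - phase (u * F' ω))) μ := (i5.sub i6).const_mul _
    rw [integral_add j123 j4, integral_sub j12 j3, integral_add j1 j2,
      integral_const_mul, integral_const_mul, integral_const_mul, integral_const_mul,
      integral_sub i1 i2, integral_sub i3 i4, integral_sub i5 i6, hzero, hXW]
    ring
  rw [key]
  have hbound : ∀ ω, ‖(Complex.I * ((X ω : ℂ) * phase (u * (F ω + W ω)) -
        (X ω : ℂ) * phase (u * F ω)) + u * (((X ω * W ω : ℝ) : ℂ) * phase (u * F ω))) -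
        u * (((X ω * W ω : ℝ) : ℂ) * phase (u * F ω) -
          ((X ω * W ω : ℝ) : ℂ) * phase (u * F' ω)) +
        u * c * (phase (u * (F ω + W ω)) - phase (u * F' ω))‖ ≤ 5 * u ^ 2 * B * L ^ 2 := by
    intro ω
    have b1 : ‖Complex.I * ((X ω : ℂ) * phase (u * (F ω + W ω)) -
        (X ω : ℂ) * phase (u * F ω)) + u * (((X ω * W ω : ℝ) : ℂ) * phase (u * F ω))‖ ≤
        2 * u ^ 2 * B * L ^ 2 := by
      have e : Complex.I * ((X ω : ℂ) * phase (u * (F ω + W ω)) -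
          (X ω : ℂ) * phase (u * F ω)) + u * (((X ω * W ω : ℝ) : ℂ) * phase (u * F ω)) =
          Complex.I * X ω * phase (u * F ω) *
            (phase (u * W ω) - 1 - Complex.I * ((u * W ω : ℝ) : ℂ)) := by
        rw [mul_add u, phase_add]
        push_cast
        linear_combination (u * X ω * W ω * phase (u * F ω) : ℂ) * Complex.I_sq
      rw [e, norm_mul, norm_mul, norm_mul, norm_phase, Complex.norm_I, one_mul, mul_one,
        Complex.norm_real, Real.norm_eq_abs]
      have hsq : (u * W ω) ^ 2 ≤ u ^ 2 * L ^ 2 := by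
        rw [mul_pow, ← sq_abs (W ω)]
        gcongr
        exact hL ω
      calc |X ω| * _ ≤ B * (2 * (u * W ω) ^ 2) :=
            mul_le_mul (hB ω) (norm_phase_sub_one_sub_le _) (norm_nonneg _) hB0
        _ ≤ B * (2 * (u ^ 2 * L ^ 2)) := by gcongr
        _ = _ := by ring
    have b2 : ‖u * (((X ω * W ω : ℝ) : ℂ) * phase (u * F ω) -
          ((X ω * W ω : ℝ) : ℂ) * phase (u * F' ω))‖ ≤ 2 * u ^ 2 * B * L ^ 2 := by
      rw [← mul_sub, norm_mul, norm_mul, Complex.norm_real, Complex.norm_real, Real.norm_eq_abs,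
        Real.norm_eq_abs]
      have h1 : |F ω - F' ω| ≤ 2 * L := by
        have := abs_sub (F ω + W ω - F' ω) (W ω)
        rw [show F ω + W ω - F' ω - W ω = F ω - F' ω by ring] at this
        linarith [hL ω, hL' ω]
      have h2 : ‖phase (u * F ω) - phase (u * F' ω)‖ ≤ |u| * (2 * L) := by
        refine (norm_phase_sub_le _ _).trans ?_
        rw [← mul_sub, abs_mul]
        gcongr
      calc |u| * (|X ω * W ω| * _) ≤ |u| * (B * L * (|u| * (2 * L))) := by
            gcongr
            exact hXWb ω
        _ = 2 * |u| ^ 2 * B * L ^ 2 := by ring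
        _ = _ := by rw [sq_abs]
    have b3 : ‖u * c * (phase (u * (F ω + W ω)) - phase (u * F' ω))‖ ≤ u ^ 2 * B * L ^ 2 := by
      rw [norm_mul, norm_mul, Complex.norm_real, Complex.norm_real, Real.norm_eq_abs,
        Real.norm_eq_abs]
      have h2 : ‖phase (u * (F ω + W ω)) - phase (u * F' ω)‖ ≤ |u| * L := by
        refine (norm_phase_sub_le _ _).trans ?_
        rw [← mul_sub, abs_mul]
        gcongr
        exact hL' ω
      calc |u| * |c| * _ ≤ |u| * (B * L) * (|u| * L) := by gcongr
        _ = |u| ^ 2 * B * L ^ 2 := by ring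
        _ = _ := by rw [sq_abs]
    refine (norm_add_le _ _).trans ?_
    have := norm_sub_le (Complex.I * ((X ω : ℂ) * phase (u * (F ω + W ω)) -
        (X ω : ℂ) * phase (u * F ω)) + u * (((X ω * W ω : ℝ) : ℂ) * phase (u * F ω)))
        (u * (((X ω * W ω : ℝ) : ℂ) * phase (u * F ω) -
          ((X ω * W ω : ℝ) : ℂ) * phase (u * F' ω)))
    linarith
  have := norm_integral_le_of_norm_le_const (μ := μ) (.of_forall hbound)
  simpa using this

lemma hasDerivAt_phase_mul (x u : ℝ) :
    HasDerivAt (fun v : ℝ => phase (v * x)) (Complex.I * (x * phase (u * x))) u := by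
  have h1 : HasDerivAt (fun v : ℝ => Complex.I * ((v * x : ℝ) : ℂ)) (Complex.I * x) u := by
    have := ((hasDerivAt_id u).mul_const x).ofReal_comp.const_mul Complex.I
    simpa using this
  have := h1.cexp
  simp only [phase]
  convert this using 1
  ring

lemma hasDerivAt_integral_phase [IsFiniteMeasure μ] {T : Ω → ℝ} (hT : Measurable T) {C : ℝ}
    (hC : ∀ ω, |T ω| ≤ C) (u : ℝ) :
    HasDerivAt (fun v : ℝ => ∫ ω, phase (v * T ω) ∂μ)
      (Complex.I * ∫ ω, (T ω : ℂ) * phase (u * T ω) ∂μ) u := by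
  rw [← integral_const_mul]
  refine (hasDerivAt_integral_of_dominated_loc_of_deriv_le (s := Set.univ) (bound := fun _ => C)
    (F := fun (v : ℝ) ω => phase (v * T ω))
    (F' := fun (v : ℝ) ω => Complex.I * ((T ω : ℂ) * phase (v * T ω))) Filter.univ_mem
    (.of_forall fun v => Measurable.aestronglyMeasurable (by fun_prop))
    (integrable_phase (by fun_prop)) (Measurable.aestronglyMeasurable (by fun_prop))
    (.of_forall fun ω v _ => ?_) (integrable_const _)
    (.of_forall fun ω v _ => hasDerivAt_phase_mul _ _)).2
  simpa using hC ω

/-- A function on `[0, 1]` that nearly solves `φ' = - σ u φ` with `φ 0 = 1` is nearly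
`exp (- σ u ^ 2 / 2)`. -/
lemma norm_sub_exp_le_of_deriv {φ φ' : ℝ → ℂ} {σ δ : ℝ} (hσ : 0 ≤ σ) (hδ : 0 ≤ δ) (h0 : φ 0 = 1)
    (hφ : ∀ u, HasDerivAt φ (φ' u) u)
    (hb : ∀ u ∈ Set.Icc (0 : ℝ) 1, ‖φ' u + u * σ * φ u‖ ≤ δ) :
    ‖φ 1 - Complex.exp (-(σ / 2 : ℝ))‖ ≤ δ := by
  -- Integrating factor, normalized so that `E 1 = 1` and `‖E‖ ≤ 1` on `[0, 1]`; the defect `δ` is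
  -- thus not amplified.
  set E : ℝ → ℂ := fun u => Complex.exp ((σ * u ^ 2 / 2 - σ / 2 : ℝ) : ℂ) with hE
  have hEd : ∀ u, HasDerivAt E (E u * (σ * u : ℝ)) u := by
    intro u
    have h1 : HasDerivAt (fun u : ℝ => σ * u ^ 2 / 2 - σ / 2) (σ * u) u := by
      have h := ((((hasDerivAt_id' u).fun_pow 2).const_mul σ).div_const 2).sub_const (σ / 2)
      exact h.congr_deriv (by simp; ring)
    exact h1.ofReal_comp.cexp
  have hEn : ∀ u ∈ Set.Icc (0 : ℝ) 1, ‖E u‖ ≤ 1 := by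
    intro u hu
    rw [hE, Complex.norm_exp, Complex.ofReal_re, Real.exp_le_one_iff]
    have : u ^ 2 ≤ 1 := pow_le_one₀ hu.1 hu.2
    nlinarith
  have h := norm_image_sub_le_of_norm_deriv_le_segment_01' (f := fun u => φ u * E u)
    (f' := fun u => φ' u * E u + φ u * (E u * (σ * u : ℝ))) (C := δ)
    (fun u _ => ((hφ u).mul (hEd u)).hasDerivWithinAt) (fun u hu => by
      have hu' : u ∈ Set.Icc (0 : ℝ) 1 := ⟨hu.1, hu.2.le⟩
      have e : φ' u * E u + φ u * (E u * (σ * u : ℝ)) = (φ' u + u * σ * φ u) * E u := by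
        push_cast; ring
      rw [e, norm_mul]
      calc _ ≤ δ * 1 := mul_le_mul (hb u hu') (hEn u hu') (norm_nonneg _) hδ
        _ = δ := mul_one δ)
  have e1 : E 1 = 1 := by simp [hE]
  have e0 : E 0 = Complex.exp (-(σ / 2 : ℝ)) := by simp [hE]
  simpa only [e1, e0, h0, mul_one, one_mul] using h

/-- **Characteristic function of a sum of bounded, centred, locally dependent random variables**,
compared with the Gaussian one of the same variance. -/
theorem norm_integral_phase_sum_sub_exp_le {ι : Type*} [DecidableEq ι] [IsProbabilityMeasure μ]
    (s : Finset ι) (Z : ι → Ω → ℝ) {B : ℝ} {d : ℕ} (hZ : ∀ i, Measurable (Z i))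
    (hB0 : 0 ≤ B) (hB : ∀ i ω, |Z i ω| ≤ B) (h0 : ∀ i, ∫ ω, Z i ω ∂μ = 0) (near near' : ι → Finset ι)
    (hnear : ∀ t ∈ s, near t ⊆ s) (hnear' : ∀ t ∈ s, near' t ⊆ s)
    (hd : ∀ t ∈ s, (near t).card ≤ d) (hd' : ∀ t ∈ s, (near' t).card ≤ d)
    (hind : ∀ t ∈ s, IndepFun (Z t) (fun ω => ∑ i ∈ s \ near t, Z i ω) μ)
    (hind' : ∀ t ∈ s, ∀ r ∈ near t,
      IndepFun (fun ω => Z t ω * Z r ω) (fun ω => ∑ i ∈ s \ near' t, Z i ω) μ) :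
    ‖∫ ω, phase (∑ i ∈ s, Z i ω) ∂μ -
      Complex.exp (-((∫ ω, (∑ i ∈ s, Z i ω) ^ 2 ∂μ) / 2 : ℝ))‖ ≤ 5 * s.card * d ^ 2 * B ^ 3 := by
  have hsum : ∀ u : Finset ι, Measurable fun ω => ∑ i ∈ u, Z i ω :=
    fun u => Finset.measurable_fun_sum _ fun i _ => hZ i
  have hsumB : ∀ (u : Finset ι) ω, |∑ i ∈ u, Z i ω| ≤ u.card * B := fun u ω => by
    refine (Finset.abs_sum_le_sum_abs _ _).trans ?_
    rw [← nsmul_eq_mul]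
    exact Finset.sum_le_card_nsmul _ _ _ fun i _ => hB i ω
  have hsplit : ∀ u, u ⊆ s → ∀ ω, ∑ i ∈ s \ u, Z i ω + ∑ i ∈ u, Z i ω = ∑ i ∈ s, Z i ω :=
    fun u hu ω => Finset.sum_sdiff hu
  have hint : ∀ (t : ι) (u : Finset ι), Integrable (fun ω => Z t ω * ∑ i ∈ u, Z i ω) μ := fun t u =>
    Integrable.of_bound ((hZ t).mul (hsum u)).aestronglyMeasurable (B * (u.card * B))
      (.of_forall fun ω => by
        rw [Real.norm_eq_abs, abs_mul]
        exact mul_le_mul (hB t ω) (hsumB u ω) (abs_nonneg _) hB0)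
  set T : Ω → ℝ := fun ω => ∑ i ∈ s, Z i ω with hT
  set σ : ℝ := ∫ ω, T ω ^ 2 ∂μ with hσ
  -- Only neighbours contribute to the variance, so the one-summand coefficients add up to exactly
  -- `σ`.
  have hσsum : σ = ∑ t ∈ s, ∫ ω, Z t ω * ∑ i ∈ near t, Z i ω ∂μ := by
    have e : ∀ ω, T ω ^ 2 = ∑ t ∈ s, Z t ω * T ω := fun ω => by
      rw [sq, ← Finset.sum_mul]
    rw [hσ, integral_congr_ae (.of_forall e), integral_finsetSum _ fun t _ => hint t s]
    refine Finset.sum_congr rfl fun t ht => ?_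
    have e2 : ∀ ω, Z t ω * T ω = Z t ω * ∑ i ∈ s \ near t, Z i ω + Z t ω * ∑ i ∈ near t, Z i ω :=
      fun ω => by rw [← mul_add, hsplit _ (hnear t ht)]
    rw [integral_congr_ae (.of_forall e2), integral_add (hint t _) (hint t _),
      (hind t ht).integral_fun_mul_eq_mul_integral (hZ t).aestronglyMeasurable
        (hsum _).aestronglyMeasurable, h0 t, zero_mul, zero_add]
  have hmain := norm_sub_exp_le_of_deriv (φ := fun u => ∫ ω, phase (u * T ω) ∂μ)
    (φ' := fun u => Complex.I * ∫ ω, (T ω : ℂ) * phase (u * T ω) ∂μ) (σ := σ)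
    (δ := 5 * s.card * d ^ 2 * B ^ 3) (integral_nonneg fun ω => sq_nonneg _) (by positivity)
    (by simp) (fun u => hasDerivAt_integral_phase (hsum s) (hsumB s) u) ?_
  · simpa only [one_mul] using hmain
  intro u hu
  have hsum1 : Complex.I * ∫ ω, (T ω : ℂ) * phase (u * T ω) ∂μ +
      u * σ * ∫ ω, phase (u * T ω) ∂μ =
      ∑ t ∈ s, (Complex.I * ∫ ω, (Z t ω : ℂ) * phase (u * T ω) ∂μ +
        u * ((∫ ω, Z t ω * ∑ i ∈ near t, Z i ω ∂μ : ℝ) : ℂ) * ∫ ω, phase (u * T ω) ∂μ) := by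
    rw [Finset.sum_add_distrib, ← Finset.sum_mul, ← Finset.mul_sum, ← Finset.mul_sum,
      ← Complex.ofReal_sum, ← hσsum, ← integral_finsetSum _ fun t _ =>
        integrable_mul_phase (hZ t) ((hsum s).const_mul u) (hB t)]
    simp only [hT, Complex.ofReal_sum, Finset.sum_mul]
  rw [hsum1]
  have hterm : ∀ t ∈ s, ‖Complex.I * ∫ ω, (Z t ω : ℂ) * phase (u * T ω) ∂μ +
        u * ((∫ ω, Z t ω * ∑ i ∈ near t, Z i ω ∂μ : ℝ) : ℂ) * ∫ ω, phase (u * T ω) ∂μ‖ ≤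
        5 * d ^ 2 * B ^ 3 := by
    intro t ht
    have hcard : ∀ v : Finset ι, v.card ≤ d → ∀ ω, |∑ i ∈ v, Z i ω| ≤ d * B := fun v hv ω =>
      (hsumB v ω).trans (mul_le_mul_of_nonneg_right (by exact_mod_cast hv) hB0)
    have h := norm_integral_mul_phase_add_le (hZ t) (hsum (near t)) (hsum (s \ near t))
      (hsum (s \ near' t)) (B := B) (L := d * B) (hB t) (hcard _ (hd t ht))
      (fun ω => by
        rw [hsplit _ (hnear t ht), ← hsplit _ (hnear' t ht), add_sub_cancel_left]
        exact hcard _ (hd' t ht) ω) (h0 t) (hind t ht) u ?_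
    · simp only [hsplit _ (hnear t ht)] at h
      refine h.trans ?_
      have hu2 : u ^ 2 ≤ 1 := pow_le_one₀ hu.1 hu.2
      calc 5 * u ^ 2 * B * (d * B) ^ 2 = u ^ 2 * (5 * d ^ 2 * B ^ 3) := by ring
        _ ≤ 1 * (5 * d ^ 2 * B ^ 3) := by gcongr
        _ = _ := one_mul _
    -- Independence is assumed pair by pair, so the neighbourhood sum is expanded before decoupling.
    · have e : ∀ ω, ((Z t ω * ∑ i ∈ near t, Z i ω : ℝ) : ℂ) * phase (u * ∑ i ∈ s \ near' t, Z i ω) =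
          ∑ r ∈ near t, ((Z t ω * Z r ω : ℝ) : ℂ) * phase (u * ∑ i ∈ s \ near' t, Z i ω) := by
        intro ω
        rw [← Finset.sum_mul, Finset.mul_sum, Complex.ofReal_sum]
      have hpair : ∀ r, Measurable fun ω => Z t ω * Z r ω := fun r => (hZ t).mul (hZ r)
      have hpairB : ∀ r ω, |Z t ω * Z r ω| ≤ B * B := fun r ω => by
        rw [abs_mul]; exact mul_le_mul (hB t ω) (hB r ω) (abs_nonneg _) hB0
      simp only [e]
      rw [integral_finsetSum _ fun r _ => integrable_mul_phase (hpair r)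
        ((hsum _).const_mul u) (hpairB r)]
      simp only [Finset.mul_sum]
      rw [integral_finsetSum _ fun r _ => Integrable.of_bound (hpair r).aestronglyMeasurable (B * B)
        (.of_forall (hpairB r)), Complex.ofReal_sum, Finset.sum_mul]
      refine Finset.sum_congr rfl fun r hr => ?_
      simpa only [Finset.mul_sum] using
        IndepFun.integral_mul_phase (hind' t ht r hr) (hpair r) (hsum _) u
  refine (norm_sum_le _ _).trans ((Finset.sum_le_sum hterm).trans (le_of_eq ?_))
  rw [Finset.sum_const, nsmul_eq_mul]
  ring

end LocalDependence

/-! ### Central limit theorem for weighted sums -/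

section CentralLimit

variable {Ω S : Type*} [MeasurableSpace S] {ε : ℤ → Ω → S}

/-- The sigma-algebra generated by the innovations with indices in `I`. -/
abbrev innovationSigma (ε : ℤ → Ω → S) (I : Set ℤ) : MeasurableSpace Ω :=
  ⨆ j ∈ I, MeasurableSpace.comap (ε j) inferInstance

lemma innovationSigma_mono {I J : Set ℤ} (h : I ⊆ J) :
    innovationSigma ε I ≤ innovationSigma ε J :=
  biSup_mono fun _ hj => h hj

/-- Letters beyond the first `m` may be frozen at `s₀` without changing `y`, so only innovations in
the window are used. -/
lemma FinDep.measurable_comp_pastSeq [Nonempty S] {m : ℕ} {y : (ℕ → S) → ℝ} (hd : FinDep m y)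
    (hy : Measurable y) {t : ℤ} {I : Set ℤ} (hI : Set.Ioc (t - m) t ⊆ I) :
    Measurable[innovationSigma ε I] (fun ω => y (pastSeq ε t ω)) := by
  obtain ⟨s₀⟩ := ‹Nonempty S›
  have he : (fun ω => y (pastSeq ε t ω)) =
      fun ω => y (fun j => if j < m then ε (t - (j : ℤ)) ω else s₀) := by
    funext ω
    exact hd _ _ fun j hj => by simp [pastSeq, hj]
  rw [he]
  refine hy.comp (@measurable_pi_lambda _ _ _ (innovationSigma ε I) _ _ fun j => ?_)
  by_cases hj : j < m
  · simp only [hj, if_true]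
    refine Measurable.mono (comap_measurable (ε (t - (j : ℤ)))) ?_ le_rfl
    exact le_iSup₂_of_le (t - (j : ℤ)) (hI ⟨by omega, by omega⟩) le_rfl
  · simp only [hj, if_false]
    exact measurable_const

variable [MeasurableSpace Ω] {μ : Measure Ω}

lemma indepFun_of_measurable_innovationSigma (hε : ∀ n, Measurable (ε n)) (hindep : iIndepFun ε μ)
    {I J : Set ℤ} (hIJ : Disjoint I J) {f g : Ω → ℝ} (hf : Measurable[innovationSigma ε I] f)
    (hg : Measurable[innovationSigma ε J] g) : IndepFun f g μ := by
  rw [IndepFun_iff_Indep]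
  exact indep_of_indep_of_le_left (indep_of_indep_of_le_right
    (indep_iSup_of_disjoint (fun j => (hε j).comap_le) hindep.iIndep hIJ) hg.comap_le) hf.comap_le

variable [IsProbabilityMeasure μ]

lemma norm_integral_phase_weighted_sum_sub_exp_le (ν : Measure S) [IsProbabilityMeasure ν]
    (hε : ∀ n, Measurable (ε n)) (hindep : iIndepFun ε μ)
    (hlaw : ∀ t, MeasurePreserving (pastSeq ε t) μ (seqMeasure ν))
    {y : (ℕ → S) → ℝ} {m : ℕ} {K : ℝ} (hy : Measurable y) (hK : ∀ v, |y v| ≤ K)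
    (hd : FinDep m y) (h0 : ∫ v, y v ∂(seqMeasure ν) = 0) (n : ℕ) (w : ℕ → ℝ) {C : ℝ}
    (hw : ∀ t, |w t| ≤ C) :
    ‖∫ ω, phase (∑ t ∈ Finset.Icc 1 n, w t * y (pastSeq ε (t : ℤ) ω)) ∂μ -
      Complex.exp (-((∫ ω, (∑ t ∈ Finset.Icc 1 n, w t * y (pastSeq ε (t : ℤ) ω)) ^ 2 ∂μ) / 2 : ℝ))‖
      ≤ 5 * n * (4 * m + 1) ^ 2 * (C * K) ^ 3 := by
  have hC0 : 0 ≤ C := (abs_nonneg _).trans (hw 0)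
  obtain ⟨v₀⟩ := nonempty_of_isProbabilityMeasure (seqMeasure ν)
  have hK0 : 0 ≤ K := (abs_nonneg _).trans (hK v₀)
  have : Nonempty S := ⟨v₀ 0⟩
  -- Times within distance `k`. Summand `t` uses the window `(t - m, t]`, so radius `m` isolates one
  -- summand and radius `2m` a pair of neighbours; both have at most `4m + 1` elements.
  set near : ℕ → ℕ → Finset ℕ := fun k t =>
    (Finset.Icc 1 n).filter fun r => r ≤ t + k ∧ t ≤ r + k with hnear
  have hcard : ∀ k, k ≤ 2 * m → ∀ t, (near k t).card ≤ 4 * m + 1 := by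
    intro k hk t
    have hsub : near k t ⊆ Finset.Icc (t - 2 * m) (t + 2 * m) := by
      intro r hr
      simp only [hnear, Finset.mem_filter, Finset.mem_Icc] at hr ⊢
      omega
    refine (Finset.card_le_card hsub).trans ?_
    rw [Nat.card_Icc]
    omega
  have hmeas : ∀ (t : ℕ) (I : Set ℤ), Set.Ioc ((t : ℤ) - m) t ⊆ I →
      Measurable[innovationSigma ε I] (fun ω => w t * y (pastSeq ε (t : ℤ) ω)) :=
    fun t I hI => (hd.measurable_comp_pastSeq hy hI).const_mul (w t)
  have hfar : ∀ (k t : ℕ), Measurable[innovationSigma ε (Set.Ioc ((t : ℤ) - m - k) (t + k))ᶜ]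
      (fun ω => ∑ i ∈ Finset.Icc 1 n \ near (m + k) t, w i * y (pastSeq ε (i : ℤ) ω)) := by
    intro k t
    refine Finset.measurable_fun_sum _ fun i hi => hmeas i _ fun j hj => ?_
    simp only [hnear, Finset.mem_sdiff, Finset.mem_filter, not_and] at hi
    simp only [Set.mem_compl_iff, Set.mem_Ioc, not_and, not_le] at hj ⊢
    intro h1
    by_contra h2
    have := hi.2 hi.1
    omega
  have h := norm_integral_phase_sum_sub_exp_le (μ := μ) (Finset.Icc 1 n)
    (fun t ω => w t * y (pastSeq ε (t : ℤ) ω)) (B := C * K) (d := 4 * m + 1)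
    (fun t => (hy.comp (measurable_pastSeq hε t)).const_mul (w t)) (by positivity)
    (fun t ω => by
      rw [abs_mul]; exact mul_le_mul (hw t) (hK _) (abs_nonneg _) hC0)
    (fun t => by
      rw [integral_const_mul, integral_comp_pastSeq ν hlaw hy.aestronglyMeasurable, h0, mul_zero])
    (near m) (near (m + m)) (fun t _ => Finset.filter_subset _ _) (fun t _ => Finset.filter_subset _ _)
    (fun t _ => hcard _ (by omega) t) (fun t _ => hcard _ (by omega) t)
    (fun t _ => indepFun_of_measurable_innovationSigma hε hindep
      (I := Set.Ioc ((t : ℤ) - m) t) disjoint_compl_right (hmeas t _ le_rfl)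
      (Measurable.mono (hfar 0 t) (innovationSigma_mono (Set.compl_subset_compl.2
        (Set.Ioc_subset_Ioc (by simp) (by simp)))) le_rfl))
    (fun t _ r hr => by
      simp only [hnear, Finset.mem_filter] at hr
      exact indepFun_of_measurable_innovationSigma hε hindep
        (I := Set.Ioc ((t : ℤ) - m - m) (t + m)) disjoint_compl_right
        ((hmeas t _ (Set.Ioc_subset_Ioc (by omega) (by omega))).mul
          (hmeas r _ (Set.Ioc_subset_Ioc (by omega) (by omega)))) (hfar m t))
  simpa using h

/-- The derivative is bounded since `|x| ≤ 1 + x² / 2 ≤ exp (x² / 2)`. Phrased in standard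
deviations, so that L² closeness of two sums controls their Gaussian limits. -/
lemma abs_exp_neg_half_sq_sub_le (a b : ℝ) :
    |Real.exp (-(a ^ 2 / 2)) - Real.exp (-(b ^ 2 / 2))| ≤ |a - b| := by
  have hd : ∀ x : ℝ, HasDerivAt (fun x : ℝ => Real.exp (-(x ^ 2 / 2)))
      (Real.exp (-(x ^ 2 / 2)) * (-x)) x := fun x => by
    have h1 := (((hasDerivAt_id' x).fun_pow 2).div_const 2).fun_neg
    exact (h1.congr_deriv (by simp)).exp
  have hb : ∀ x : ℝ, ‖Real.exp (-(x ^ 2 / 2)) * (-x)‖ ≤ 1 := fun x => by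
    rw [norm_mul, norm_neg, Real.norm_eq_abs, Real.norm_eq_abs, Real.abs_exp, Real.exp_neg,
      inv_mul_le_one₀ (Real.exp_pos _)]
    have := Real.add_one_le_exp (x ^ 2 / 2)
    nlinarith [sq_nonneg (|x| - 1), sq_abs x]
  have := Convex.norm_image_sub_le_of_norm_hasDerivWithin_le (s := Set.univ)
    (f := fun x : ℝ => Real.exp (-(x ^ 2 / 2))) (fun x _ => (hd x).hasDerivWithinAt)
    (fun x _ => hb x) convex_univ (Set.mem_univ b) (Set.mem_univ a)
  simpa using this

lemma norm_integral_phase_sub_le_lpNorm {T T' : Ω → ℝ} (hT : Measurable T) (hT' : Measurable T')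
    (h : MemLp (T - T') 2 μ) :
    ‖∫ ω, phase (T ω) ∂μ - ∫ ω, phase (T' ω) ∂μ‖ ≤ lpNorm (T - T') 2 μ := by
  rw [← integral_sub (integrable_phase hT) (integrable_phase hT')]
  refine (norm_integral_le_integral_norm _).trans ?_
  have h1 : ∫ ω, ‖phase (T ω) - phase (T' ω)‖ ∂μ ≤ ∫ ω, |(T - T') ω| ∂μ :=
    integral_mono ((integrable_phase hT).sub (integrable_phase hT')).norm
      (h.integrable one_le_two).abs fun ω => norm_phase_sub_le _ _
  have h2 := abs_integral_le_lpNorm_two h.norm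
  rw [abs_of_nonneg (integral_nonneg fun ω => norm_nonneg _)] at h2
  refine h1.trans (h2.trans (le_of_eq ?_))
  exact lpNorm_fun_abs h.1 2

/-- **Central limit theorem for weighted sums** of a causal process with summable projections, in
terms of characteristic functions. -/
theorem tendsto_integral_phase_weighted_sum (ν : Measure S) [IsProbabilityMeasure ν]
    (hε : ∀ n, Measurable (ε n)) (hindep : iIndepFun ε μ)
    (hlaw : ∀ t, MeasurePreserving (pastSeq ε t) μ (seqMeasure ν))
    {f : (ℕ → S) → ℝ} (hf : Measurable f) (h2 : MemLp f 2 (seqMeasure ν))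
    (h0 : ∫ v, f v ∂(seqMeasure ν) = 0)
    (hs : Summable fun j => lpNorm (incrIter ν f j) 2 (seqMeasure ν))
    (w : ℕ → ℕ → ℝ) {C v : ℝ} (hw : ∀ n t, |w n t| ≤ C)
    (hv : Tendsto (fun n : ℕ => ∫ ω, (∑ t ∈ Finset.Icc 1 n,
      w n t / √n * f (pastSeq ε (t : ℤ) ω)) ^ 2 ∂μ) atTop (𝓝 v)) :
    Tendsto (fun n : ℕ => ∫ ω, phase (∑ t ∈ Finset.Icc 1 n,
      w n t / √n * f (pastSeq ε (t : ℤ) ω)) ∂μ) atTop (𝓝 (Complex.exp (-(v / 2 : ℝ)))) := by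
  have hC0 : 0 ≤ C := (abs_nonneg _).trans (hw 0 0)
  have hsum : ∀ {g : (ℕ → S) → ℝ}, MemLp g 2 (seqMeasure ν) → ∀ n : ℕ, MemLp (fun ω =>
      ∑ t ∈ Finset.Icc 1 n, w n t / √n * g (pastSeq ε (t : ℤ) ω)) 2 μ := fun hg n =>
    memLp_finsetSum _ fun t _ => (memLp_comp_pastSeq ν hlaw hg _).const_mul _
  have hmeas : ∀ {g : (ℕ → S) → ℝ}, Measurable g → ∀ n : ℕ, Measurable (fun ω =>
      ∑ t ∈ Finset.Icc 1 n, w n t / √n * g (pastSeq ε (t : ℤ) ω)) := fun hg n =>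
    Finset.measurable_fun_sum _ fun t _ => (hg.comp (measurable_pastSeq hε t)).const_mul _
  have hexp : Tendsto (fun n : ℕ => Complex.exp (-((∫ ω, (∑ t ∈ Finset.Icc 1 n,
      w n t / √n * f (pastSeq ε (t : ℤ) ω)) ^ 2 ∂μ) / 2 : ℝ))) atTop
      (𝓝 (Complex.exp (-(v / 2 : ℝ)))) := by
    have hc : Continuous fun x : ℝ => Complex.exp (-(x / 2 : ℝ)) := by fun_prop
    exact (hc.tendsto v).comp hv
  have hdiff : Tendsto (fun n : ℕ => ∫ ω, phase (∑ t ∈ Finset.Icc 1 n,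
      w n t / √n * f (pastSeq ε (t : ℤ) ω)) ∂μ - Complex.exp (-((∫ ω, (∑ t ∈ Finset.Icc 1 n,
      w n t / √n * f (pastSeq ε (t : ℤ) ω)) ^ 2 ∂μ) / 2 : ℝ))) atTop (𝓝 0) := by
    rw [Metric.tendsto_atTop]
    intro δ hδ
    -- This `η` makes the approximation error at most `δ / 4`; `C + 1` covers `C = 0`. Since `m` and
    -- `K` are fixed before `n`, the local dependence error is `n` times a constant times
    -- `(n^(-1/2))³`, which tends to `0`.
    obtain ⟨y, m, K, hy, hK, hd, hy2, hy0, happ⟩ := exists_finDep_approx ν hlaw hf h2 h0 hs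
      (η := δ / (4 * (C + 1))) (by positivity)
    have hstein : Tendsto (fun n : ℕ => 5 * (n : ℝ) * (4 * m + 1) ^ 2 * (C / √n * K) ^ 3) atTop
        (𝓝 0) := by
      have h1 : Tendsto (fun n : ℕ => 5 * (4 * m + 1) ^ 2 * (C * K) ^ 3 * (√(n : ℝ))⁻¹) atTop
          (𝓝 (5 * (4 * m + 1) ^ 2 * (C * K) ^ 3 * 0)) :=
        (tendsto_inv_atTop_zero.comp
          (Real.tendsto_sqrt_atTop.comp tendsto_natCast_atTop_atTop)).const_mul _
      rw [mul_zero] at h1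
      refine h1.congr' ?_
      filter_upwards [eventually_gt_atTop 0] with n hn
      have hn' : (0 : ℝ) < √n := Real.sqrt_pos.2 (by exact_mod_cast hn)
      have hsq : (n : ℝ) = √n ^ 2 := (Real.sq_sqrt (Nat.cast_nonneg n)).symm
      rw [hsq, Real.sqrt_sq hn'.le]
      field_simp
    obtain ⟨N, hN⟩ := Metric.tendsto_atTop.1 hstein (δ / 2) (half_pos hδ)
    refine ⟨max N 1, fun n hn => ?_⟩
    have hn1 : 0 < n := (le_max_right N 1).trans hn
    have hn' : (0 : ℝ) < √n := Real.sqrt_pos.2 (by exact_mod_cast hn1)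
    have hwn : ∀ t, |w n t / √n| ≤ C / √n := fun t => by
      rw [abs_div, abs_of_pos hn']; gcongr; exact hw n t
    set T : Ω → ℝ := fun ω => ∑ t ∈ Finset.Icc 1 n, w n t / √n * f (pastSeq ε (t : ℤ) ω) with hT
    set T' : Ω → ℝ := fun ω => ∑ t ∈ Finset.Icc 1 n, w n t / √n * y (pastSeq ε (t : ℤ) ω) with hT'
    have hTT : lpNorm (T - T') 2 μ ≤ δ / 4 := by
      have h := happ n (fun t => w n t / √n) (C / √n) (by positivity) hwn
      have e : T - T' = fun ω => ∑ t ∈ Finset.Icc 1 n,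
          w n t / √n * (f (pastSeq ε (t : ℤ) ω) - y (pastSeq ε (t : ℤ) ω)) := by
        funext ω
        simp only [hT, hT', Pi.sub_apply, mul_sub, Finset.sum_sub_distrib]
      rw [e]
      refine h.trans ?_
      rw [div_mul_cancel₀ _ hn'.ne', div_mul_eq_mul_div, div_le_div_iff₀ (by positivity)
        (by positivity)]
      nlinarith
    have hTm : MemLp T 2 μ := hsum h2 n
    have hTm' : MemLp T' 2 μ := hsum hy2 n
    have b1 : ‖∫ ω, phase (T ω) ∂μ - ∫ ω, phase (T' ω) ∂μ‖ ≤ δ / 4 :=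
      (norm_integral_phase_sub_le_lpNorm (hmeas hf n) (hmeas hy n) (hTm.sub hTm')).trans hTT
    have b2 : ‖∫ ω, phase (T' ω) ∂μ - Complex.exp (-((∫ ω, T' ω ^ 2 ∂μ) / 2 : ℝ))‖ < δ / 2 := by
      have h := norm_integral_phase_weighted_sum_sub_exp_le ν hε hindep hlaw hy hK hd hy0 n
        (fun t => w n t / √n) hwn
      have h3 := hN n ((le_max_left N 1).trans hn)
      rw [Real.dist_eq, sub_zero] at h3
      exact h.trans_lt ((le_abs_self _).trans_lt h3)
    have b3 : ‖Complex.exp (-((∫ ω, T' ω ^ 2 ∂μ) / 2 : ℝ)) -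
        Complex.exp (-((∫ ω, T ω ^ 2 ∂μ) / 2 : ℝ))‖ ≤ δ / 4 := by
      rw [← lpNorm_two_sq hTm, ← lpNorm_two_sq hTm', ← Complex.ofReal_neg, ← Complex.ofReal_neg,
        ← Complex.ofReal_exp, ← Complex.ofReal_exp, ← Complex.ofReal_sub, Complex.norm_real,
        Real.norm_eq_abs]
      refine (abs_exp_neg_half_sq_sub_le _ _).trans (le_trans ?_ hTT)
      have h3 := lpNorm_le_lpNorm_add_lpNorm_sub' (f := T) hTm' (p := 2) one_le_two
      have h4 := lpNorm_le_lpNorm_add_lpNorm_sub' (f := T') hTm (p := 2) one_le_two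
      rw [lpNorm_sub_comm] at h4
      rw [abs_le]
      constructor <;> linarith
    rw [dist_zero_right]
    calc ‖∫ ω, phase (T ω) ∂μ - Complex.exp (-((∫ ω, T ω ^ 2 ∂μ) / 2 : ℝ))‖
        = ‖(∫ ω, phase (T ω) ∂μ - ∫ ω, phase (T' ω) ∂μ) +
          (∫ ω, phase (T' ω) ∂μ - Complex.exp (-((∫ ω, T' ω ^ 2 ∂μ) / 2 : ℝ))) +
          (Complex.exp (-((∫ ω, T' ω ^ 2 ∂μ) / 2 : ℝ)) -
            Complex.exp (-((∫ ω, T ω ^ 2 ∂μ) / 2 : ℝ)))‖ := by congr 1; ring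
      _ ≤ _ := norm_add₃_le
      _ < δ := by linarith
  simpa using hdiff.add hexp

end CentralLimit

/-! ### Toeplitz forms at Fourier frequencies -/

section Fourier

/-- The cosine series with coefficients `r`. -/
def cosSeries (r : ℤ → ℝ) (θ : ℝ) : ℝ := ∑' k : ℤ, r k * Real.cos (k * θ)

lemma phase_re (x : ℝ) : (phase x).re = Real.cos x := by
  rw [phase, mul_comm, Complex.exp_ofReal_mul_I_re]

lemma phase_neg (x : ℝ) : phase (-x) = (starRingEnd ℂ) (phase x) := by
  rw [phase, phase, ← Complex.exp_conj]
  simp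

lemma phase_nat_mul (n : ℕ) (x : ℝ) : phase (n * x) = phase x ^ n := by
  rw [phase, phase, ← Complex.exp_nat_mul]
  push_cast
  ring_nf

variable {r : ℤ → ℝ}

lemma summable_mul_phase (hr : Summable fun k => |r k|) (g : ℤ → ℝ) :
    Summable fun k => (r k : ℂ) * phase (g k) :=
  Summable.of_norm (by simpa using hr)

lemma tsum_mul_phase (hr : Summable fun k => |r k|) (heven : ∀ k, r (-k) = r k) (θ : ℝ) :
    ∑' k : ℤ, (r k : ℂ) * phase (k * θ) = cosSeries r θ := by
  have hs := summable_mul_phase hr fun k => k * θ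
  refine Complex.ext ?_ ?_
  · rw [Complex.re_tsum hs, Complex.ofReal_re]
    simp only [Complex.re_ofReal_mul, phase_re, cosSeries]
  · rw [Complex.im_tsum hs, Complex.ofReal_im]
    have h := (Equiv.neg ℤ).tsum_eq fun k => ((r k : ℂ) * phase (k * θ)).im
    simp only [Equiv.neg_apply, heven, Int.cast_neg, neg_mul, phase_neg, Complex.im_ofReal_mul,
      Complex.conj_im, mul_neg, tsum_neg] at h ⊢
    linarith

/-- Exponentials are eigenfunctions of convolution by `r`; evenness makes the eigenvalue real, so
real parts may be taken. -/
lemma hasSum_mul_re_phase (hr : Summable fun k => |r k|) (heven : ∀ k, r (-k) = r k) (θ : ℝ)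
    (A : ℂ) (t : ℤ) :
    HasSum (fun h : ℤ => r h * (A * phase (-((t + h : ℤ) * θ))).re)
      (cosSeries r θ * (A * phase (-(t * θ))).re) := by
  have h1 : HasSum (fun h : ℤ => (r h : ℂ) * phase (h * (-θ))) (cosSeries r θ) := by
    have := (summable_mul_phase hr fun k => k * (-θ)).hasSum
    rw [tsum_mul_phase hr heven] at this
    convert this using 2
    simp [cosSeries]
  have h2 := Complex.hasSum_re (h1.mul_left (A * phase (-(t * θ))))
  have e : (A * phase (-(t * θ)) * (cosSeries r θ : ℂ)).re =
      cosSeries r θ * (A * phase (-(t * θ))).re := by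
    rw [mul_comm, Complex.re_ofReal_mul]
  rw [e] at h2
  refine h2.congr_fun fun h => ?_
  rw [← Complex.re_ofReal_mul]
  congr 1
  rw [show -(((t + h : ℤ) : ℝ) * θ) = -(t * θ) + h * (-θ) by push_cast; ring, phase_add]
  ring

lemma sum_Icc_natCast {M : Type*} [AddCommMonoid M] (n : ℕ) (F : ℤ → M) :
    ∑ t ∈ Finset.Icc 1 n, F (t : ℤ) = ∑ t ∈ Finset.Icc (1 : ℤ) n, F t := by
  refine Finset.sum_bij (fun t _ => (t : ℤ)) (fun t ht => ?_) (fun a _ b _ hab => by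
    exact_mod_cast hab) (fun t ht => ⟨t.toNat, ?_, ?_⟩) fun _ _ => rfl
  all_goals
    simp only [Finset.mem_Icc] at ht ⊢
    omega

lemma card_filter_add_notMem_le (n : ℕ) (h : ℤ) :
    (((Finset.Icc (1 : ℤ) n).filter fun t => t + h ∉ Finset.Icc (1 : ℤ) n).card : ℝ) ≤
      min (n : ℝ) |(h : ℝ)| := by
  refine le_min ?_ ?_
  · have := Finset.card_filter_le (Finset.Icc (1 : ℤ) n) fun t => t + h ∉ Finset.Icc (1 : ℤ) n
    rw [Int.card_Icc] at this
    have h2 : ((Finset.Icc (1 : ℤ) n).filter fun t => t + h ∉ Finset.Icc (1 : ℤ) n).card ≤ n := by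
      omega
    exact_mod_cast h2
  · have h1 : ((Finset.Icc (1 : ℤ) n).filter fun t => t + h ∉ Finset.Icc (1 : ℤ) n).card ≤
        h.natAbs := by
      rcases le_total 0 h with hh | hh
      · refine (Finset.card_le_card (t := Finset.Ioc ((n : ℤ) - h) n) fun t ht => ?_).trans ?_
        · simp only [Finset.mem_filter, Finset.mem_Icc, Finset.mem_Ioc] at ht ⊢
          omega
        · rw [Int.card_Ioc]; omega
      · refine (Finset.card_le_card (t := Finset.Ico 1 (1 - h)) fun t ht => ?_).trans ?_
        · simp only [Finset.mem_filter, Finset.mem_Icc, Finset.mem_Ico] at ht ⊢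
          omega
        · rw [Int.card_Ico]; omega
    have h2 : ((h.natAbs : ℕ) : ℝ) = |(h : ℝ)| := by
      rw [Nat.cast_natAbs, Int.cast_abs]
    rw [← h2]
    exact_mod_cast h1

/-- Letting the inner index range over all of `ℤ` turns the form into a convolution. The error comes
from pairs `(t, t + h)` with `t + h` outside the window, at most `min n |h|` for each lag. -/
lemma abs_toeplitz_sub_le (hr : Summable fun k => |r k|) (w : ℤ → ℝ) {C : ℝ}
    (hw : ∀ t, |w t| ≤ C) (n : ℕ) :
    |∑ t ∈ Finset.Icc (1 : ℤ) n, ∑ s ∈ Finset.Icc (1 : ℤ) n, w t * w s * r (s - t) -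
      ∑ t ∈ Finset.Icc (1 : ℤ) n, w t * ∑' h, r h * w (t + h)| ≤
      C ^ 2 * ∑' h : ℤ, |r h| * min (n : ℝ) |(h : ℝ)| := by
  classical
  have hC0 : 0 ≤ C := (abs_nonneg _).trans (hw 0)
  set I := Finset.Icc (1 : ℤ) n with hI
  have hsum1 : ∀ t, Summable fun h => r h * w (t + h) := fun t => by
    refine Summable.of_norm_bounded (hr.mul_right C) fun h => ?_
    rw [norm_mul]
    exact mul_le_mul_of_nonneg_left (hw _) (abs_nonneg _)
  have hfin : ∀ t, ∑ s ∈ I, w s * r (s - t) = ∑' h, if t + h ∈ I then r h * w (t + h) else 0 := by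
    intro t
    rw [← (Equiv.addLeft (-t)).tsum_eq]
    simp only [Equiv.coe_addLeft, add_neg_cancel_left]
    rw [tsum_eq_sum (s := I) fun s hs => by rw [if_neg hs]]
    refine Finset.sum_congr rfl fun s hs => ?_
    rw [if_pos hs, mul_comm, neg_add_eq_sub]
  have hsum2 : ∀ t, Summable fun h => if t + h ∈ I then r h * w (t + h) else 0 := fun t => by
    refine Summable.of_norm_bounded (hsum1 t).norm fun h => ?_
    split_ifs
    · exact le_rfl
    · rw [norm_zero]; exact norm_nonneg _
  have hsum3 : ∀ t, Summable fun h => if t + h ∈ I then 0 else |r h| := fun t => by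
    refine Summable.of_norm_bounded hr fun h => ?_
    split_ifs <;> simp
  have hterm : ∀ t ∈ I, |w t * ∑ s ∈ I, w s * r (s - t) - w t * ∑' h, r h * w (t + h)| ≤
      C ^ 2 * ∑' h, if t + h ∈ I then 0 else |r h| := by
    intro t _
    rw [hfin, ← mul_sub, ← (hsum2 t).tsum_sub (hsum1 t), abs_mul, sq, mul_assoc, ← tsum_mul_left]
    refine mul_le_mul (hw t) ?_ (abs_nonneg _) hC0
    rw [← Real.norm_eq_abs]
    refine tsum_of_norm_bounded ((hsum3 t).mul_left C).hasSum fun h => ?_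
    split_ifs
    · simp
    · rw [zero_sub, norm_neg, norm_mul, mul_comm]
      exact mul_le_mul_of_nonneg_right (hw _) (abs_nonneg _)
  have e : ∑ t ∈ I, ∑ s ∈ I, w t * w s * r (s - t) - ∑ t ∈ I, w t * ∑' h, r h * w (t + h) =
      ∑ t ∈ I, (w t * ∑ s ∈ I, w s * r (s - t) - w t * ∑' h, r h * w (t + h)) := by
    rw [Finset.sum_sub_distrib]
    simp only [Finset.mul_sum, mul_assoc]
  rw [e]
  refine (Finset.abs_sum_le_sum_abs _ _).trans ((Finset.sum_le_sum hterm).trans ?_)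
  rw [← Finset.mul_sum, ← Summable.tsum_finsetSum fun t _ => hsum3 t]
  refine mul_le_mul_of_nonneg_left ?_ (sq_nonneg C)
  have hsum4 : Summable fun h : ℤ => |r h| * min (n : ℝ) |(h : ℝ)| :=
    Summable.of_nonneg_of_le (fun h => by positivity)
      (fun h => mul_le_mul_of_nonneg_left (min_le_left _ _) (abs_nonneg _)) (hr.mul_right (n : ℝ))
  refine Summable.tsum_le_tsum (fun h => ?_) (summable_sum fun t _ => hsum3 t) hsum4
  have e2 : ∑ t ∈ I, (if t + h ∈ I then 0 else |r h|) =
      |r h| * ((I.filter fun t => t + h ∉ I).card : ℝ) := by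
    rw [Finset.card_filter, Nat.cast_sum, Finset.mul_sum]
    refine Finset.sum_congr rfl fun t _ => ?_
    split_ifs <;> simp
  rw [e2]
  exact mul_le_mul_of_nonneg_left (card_filter_add_notMem_le n h) (abs_nonneg _)

/-- Dominated convergence with majorant `|r h|`; no summability of `|h| |r h|` is needed. -/
lemma tendsto_tsum_mul_min_div (hr : Summable fun k => |r k|) :
    Tendsto (fun n : ℕ => (∑' h : ℤ, |r h| * min (n : ℝ) |(h : ℝ)|) / n) atTop (𝓝 0) := by
  have h := tendsto_tsum_of_dominated_convergence (𝓕 := atTop) (bound := fun h : ℤ => |r h|)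
    (f := fun (n : ℕ) (h : ℤ) => |r h| * min (n : ℝ) |(h : ℝ)| / n) (g := fun _ => (0 : ℝ)) hr ?_ ?_
  · simpa only [tsum_zero, tsum_div_const] using h
  · intro k
    have h1 : Tendsto (fun n : ℕ => |r k| * |(k : ℝ)| / n) atTop (𝓝 0) :=
      tendsto_const_div_atTop_nhds_zero_nat _
    refine squeeze_zero (fun n => by positivity) (fun n => ?_) h1
    gcongr
    exact min_le_right _ _
  · refine .of_forall fun n k => ?_
    rw [Real.norm_of_nonneg (by positivity)]
    refine div_le_of_le_mul₀ (by positivity) (abs_nonneg _) ?_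
    exact mul_le_mul_of_nonneg_left (min_le_left _ _) (abs_nonneg _)

lemma sum_phase_eq_zero {n : ℕ} {k : ℤ} (hk0 : k ≠ 0) (hk : |k| < n) :
    ∑ t ∈ Finset.Icc 1 n, phase (-(t * (2 * Real.pi * k / n))) = 0 := by
  have hn : (n : ℝ) ≠ 0 := by
    have : 0 < n := by have := abs_nonneg k; omega
    exact_mod_cast this.ne'
  set ζ := phase (-(2 * Real.pi * k / n)) with hζ
  have hpow : ∀ t : ℕ, phase (-(t * (2 * Real.pi * k / n))) = ζ ^ t := fun t => by
    rw [hζ, ← phase_nat_mul, mul_neg]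
  have hζn : ζ ^ n = 1 := by
    rw [← hpow, mul_div_cancel₀ _ hn, phase, Complex.exp_eq_one_iff]
    exact ⟨-k, by push_cast; ring⟩
  have hζ1 : ζ ≠ 1 := by
    rw [hζ, phase, Ne, Complex.exp_eq_one_iff]
    rintro ⟨m, hm⟩
    have h1 : (-(2 * Real.pi * k / n) : ℝ) = m * (2 * Real.pi) := by
      have h2 : Complex.I * ((-(2 * Real.pi * k / n) : ℝ) : ℂ) =
          Complex.I * ((m * (2 * Real.pi) : ℝ) : ℂ) := by
        rw [hm]; push_cast; ring
      exact_mod_cast mul_left_cancel₀ Complex.I_ne_zero h2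
    have h3 : (-k : ℝ) = m * n := by
      have hpi := Real.pi_ne_zero
      field_simp at h1
      linarith
    have h4 : -k = m * n := by exact_mod_cast h3
    have h5 : (n : ℤ) ∣ k := ⟨-m, by linarith⟩
    exact hk0 (Int.eq_zero_of_abs_lt_dvd h5 hk)
  simp only [hpow]
  have h6 : ∑ t ∈ Finset.Icc 1 n, ζ ^ t = ζ * ∑ t ∈ Finset.range n, ζ ^ t := by
    rw [Finset.mul_sum, Finset.range_eq_Ico, ← Finset.Ico_add_one_right_eq_Icc,
      Finset.sum_Ico_add' (fun t => ζ ^ t) 0 n 1 |>.symm.trans (Finset.sum_congr rfl fun t _ => pow_succ' ζ t)]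
  have h7 := geom_sum_mul ζ n
  rw [hζn, sub_self] at h7
  rw [h6, (mul_eq_zero.1 h7).resolve_right (sub_ne_zero.2 hζ1), mul_zero]

lemma re_mul_re (z w : ℂ) : z.re * w.re = (z * w + z * (starRingEnd ℂ) w).re / 2 := by
  simp only [Complex.add_re, Complex.mul_re, Complex.conj_re, Complex.conj_im]
  ring

/-- The product splits into frequencies `a + b` and `a - b`. The range of the indices forces `0 < a
+ b < n`, so the first always sums to zero, and the second does unless `a = b`. -/
lemma sum_re_phase_mul_re_phase {n a b : ℕ} (ha : 1 ≤ a ∧ a ≤ (n - 1) / 2)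
    (hb : 1 ≤ b ∧ b ≤ (n - 1) / 2) (A B : ℂ) :
    ∑ t ∈ Finset.Icc 1 n, (A * phase (-(t * fourierFreq n a))).re *
      (B * phase (-(t * fourierFreq n b))).re =
      if a = b then n * (A * (starRingEnd ℂ) B).re / 2 else 0 := by
  have hterm : ∀ t : ℕ, (A * phase (-(t * fourierFreq n a))).re *
      (B * phase (-(t * fourierFreq n b))).re =
      (A * B * phase (-(t * (2 * Real.pi * ((a + b : ℕ) : ℤ) / n))) +
        A * (starRingEnd ℂ) B * phase (-(t * (2 * Real.pi * ((a : ℤ) - b : ℤ) / n)))).re / 2 := by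
    intro t
    have e1 : -(t * (2 * Real.pi * (((a + b : ℕ) : ℤ) : ℝ) / n)) =
        -(t * fourierFreq n a) + -(t * fourierFreq n b) := by
      simp only [fourierFreq]; push_cast; ring
    have e2 : -(t * (2 * Real.pi * (((a : ℤ) - b : ℤ) : ℝ) / n)) =
        -(t * fourierFreq n a) + t * fourierFreq n b := by
      simp only [fourierFreq]; push_cast; ring
    rw [re_mul_re, e1, e2, phase_add, phase_add, map_mul, phase_neg (t * fourierFreq n b),
      Complex.conj_conj]
    congr 2
    ring
  simp only [hterm]
  rw [← Finset.sum_div, ← Complex.re_sum, Finset.sum_add_distrib, ← Finset.mul_sum,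
    ← Finset.mul_sum, sum_phase_eq_zero (k := ((a + b : ℕ) : ℤ)) (by omega)
      (by rw [abs_of_nonneg (by omega)]; omega), mul_zero, zero_add]
  split_ifs with hab
  · subst hab
    simp [mul_comm]
  · rw [sum_phase_eq_zero (k := (a : ℤ) - b) (by omega) (by rw [abs_lt]; omega)]
    simp

/-- **Asymptotic variance** of weighted sums of a stationary sequence with summable covariances
whose weights are trigonometric polynomials at Fourier frequencies. -/
theorem tendsto_toeplitz_trig (hr : Summable fun k => |r k|) (heven : ∀ k, r (-k) = r k)
    {q : ℕ} {l : ℕ → Fin q → ℕ} (hl_inj : ∀ᶠ n in atTop, Function.Injective (l n))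
    (hl_mem : ∀ᶠ n in atTop, ∀ j, 1 ≤ l n j ∧ l n j ≤ (n - 1) / 2)
    (A : ℕ → Fin q → ℂ) {C v : ℝ} (hA : ∀ n j, ‖A n j‖ ≤ C)
    (hv : ∀ n, ∑ j, cosSeries r (fourierFreq n (l n j)) * (‖A n j‖ ^ 2 / 2) = v) :
    Tendsto (fun n : ℕ => (∑ t ∈ Finset.Icc 1 n, ∑ s ∈ Finset.Icc 1 n,
      (∑ j, (A n j * phase (-(t * fourierFreq n (l n j)))).re) *
      (∑ j, (A n j * phase (-(s * fourierFreq n (l n j)))).re) * r ((s : ℤ) - t)) / n)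
      atTop (𝓝 v) := by
  set w : ℕ → ℤ → ℝ := fun n t => ∑ j, (A n j * phase (-(t * fourierFreq n (l n j)))).re with hw
  have hwb : ∀ n t, |w n t| ≤ q * C := fun n t => by
    refine (Finset.abs_sum_le_sum_abs _ _).trans ?_
    refine (Finset.sum_le_card_nsmul _ _ C fun j _ => ?_).trans (by simp)
    refine (Complex.abs_re_le_norm _).trans ?_
    rw [norm_mul, norm_phase, mul_one]
    exact hA n j
  -- The convolution form equals `v` exactly for large `n`; the limit is needed for the edge effects
  -- alone.
  have hmain : ∀ᶠ n : ℕ in atTop,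
      (∑ t ∈ Finset.Icc (1 : ℤ) n, w n t * ∑' h, r h * w n (t + h)) / n = v := by
    filter_upwards [hl_inj, hl_mem, eventually_gt_atTop 0] with n hinj hmem hn
    have hn' : (n : ℝ) ≠ 0 := by exact_mod_cast hn.ne'
    have h1 : ∀ t : ℤ, ∑' h, r h * w n (t + h) =
        ∑ j, cosSeries r (fourierFreq n (l n j)) *
          (A n j * phase (-(t * fourierFreq n (l n j)))).re := fun t => by
      refine HasSum.tsum_eq ?_
      simp only [hw, Finset.mul_sum]
      exact hasSum_sum fun j _ => hasSum_mul_re_phase hr heven _ _ t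
    simp only [h1]
    rw [← sum_Icc_natCast n fun t => w n t * ∑ j, cosSeries r (fourierFreq n (l n j)) *
          (A n j * phase (-(t * fourierFreq n (l n j)))).re]
    rw [← hv n, div_eq_iff hn', Finset.sum_mul]
    simp only [hw, Finset.mul_sum]
    rw [Finset.sum_comm]
    refine Finset.sum_congr rfl fun j _ => ?_
    simp only [Finset.sum_mul]
    rw [Finset.sum_comm, Finset.sum_eq_single_of_mem j (Finset.mem_univ j)]
    · have h2 := sum_re_phase_mul_re_phase (hmem j) (hmem j) (A n j) (A n j)
      rw [if_pos rfl, Complex.mul_conj, Complex.ofReal_re, Complex.normSq_eq_norm_sq] at h2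
      have h3 : ∀ t : ℕ, (A n j * phase (-(((t : ℤ) : ℝ) * fourierFreq n (l n j)))).re *
          (cosSeries r (fourierFreq n (l n j)) *
            (A n j * phase (-(((t : ℤ) : ℝ) * fourierFreq n (l n j)))).re) =
          cosSeries r (fourierFreq n (l n j)) * ((A n j * phase (-(t * fourierFreq n (l n j)))).re *
            (A n j * phase (-(t * fourierFreq n (l n j)))).re) := fun t => by
        rw [Int.cast_natCast]; ring
      simp only [h3]
      rw [← Finset.mul_sum, h2]
      ring
    · intro i _ hij
      have h2 := sum_re_phase_mul_re_phase (hmem i) (hmem j) (A n i) (A n j)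
      rw [if_neg fun h => hij (hinj h)] at h2
      have h3 : ∀ t : ℕ, (A n i * phase (-(((t : ℤ) : ℝ) * fourierFreq n (l n i)))).re *
          (cosSeries r (fourierFreq n (l n j)) *
            (A n j * phase (-(((t : ℤ) : ℝ) * fourierFreq n (l n j)))).re) =
          cosSeries r (fourierFreq n (l n j)) * ((A n i * phase (-(t * fourierFreq n (l n i)))).re *
            (A n j * phase (-(t * fourierFreq n (l n j)))).re) := fun t => by
        rw [Int.cast_natCast]; ring
      simp only [h3]
      rw [← Finset.mul_sum, h2, mul_zero]
  have herr : Tendsto (fun n : ℕ => (∑ t ∈ Finset.Icc (1 : ℤ) n, ∑ s ∈ Finset.Icc (1 : ℤ) n,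
      w n t * w n s * r (s - t)) / n -
      (∑ t ∈ Finset.Icc (1 : ℤ) n, w n t * ∑' h, r h * w n (t + h)) / n) atTop (𝓝 0) := by
    have h1 := (tendsto_tsum_mul_min_div hr).const_mul ((q * C) ^ 2)
    rw [mul_zero] at h1
    refine squeeze_zero_norm (fun n => ?_) h1
    rw [← sub_div, norm_div, Real.norm_natCast, Real.norm_eq_abs, ← mul_div_assoc]
    exact div_le_div_of_nonneg_right (abs_toeplitz_sub_le hr (w n) (hwb n) n) (Nat.cast_nonneg n)
  have hlim := herr.add (tendsto_const_nhds.congr' (hmain.mono fun n hn => hn.symm))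
  rw [zero_add] at hlim
  refine hlim.congr fun n => ?_
  rw [sub_add_cancel]
  congr 1
  rw [← sum_Icc_natCast n fun t => ∑ s ∈ Finset.Icc (1 : ℤ) n, w n t * w n s * r (s - t)]
  refine Finset.sum_congr rfl fun t _ => ?_
  rw [← sum_Icc_natCast n fun s => w n t * w n s * r (s - t)]
  simp only [hw, Int.cast_natCast]

end Fourier

/-! ### Gaussian and exponential characteristic functions -/

section LimitLaws

variable {Ω : Type*} [MeasurableSpace Ω] {P : Measure Ω}

lemma charFun_map_real_eq_integral_phase {T : Ω → ℝ} (hT : AEMeasurable T P) (t : ℝ) :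
    charFun (P.map T) t = ∫ ω, phase (t * T ω) ∂P := by
  rw [charFun_apply_real, integral_map hT (Measurable.aestronglyMeasurable (by fun_prop))]
  refine integral_congr_ae (.of_forall fun ω => ?_)
  simp only [phase]
  push_cast
  ring_nf

lemma integral_phase_sum_gaussian [IsProbabilityMeasure P] {ι : Type*} [Fintype ι]
    {Y : ι → Ω → ℝ} (hind : iIndepFun Y P) (hY : ∀ i, HasLaw (Y i) (gaussianReal 0 1) P)
    (a : ι → ℝ) :
    ∫ ω, phase (∑ i, a i * Y i ω) ∂P = Complex.exp (-((∑ i, a i ^ 2) / 2 : ℝ)) := by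
  have hm : ∀ i, AEMeasurable (fun ω => a i * Y i ω) P := fun i =>
    (hY i).aemeasurable.const_mul (a i)
  have hind' : iIndepFun (fun i ω => a i * Y i ω) P :=
    hind.comp (fun i x => a i * x) fun i => measurable_const_mul (a i)
  have h := congrFun (hind'.charFun_map_fun_sum_eq_prod hm) 1
  rw [charFun_map_real_eq_integral_phase (Finset.aemeasurable_fun_sum _ fun i _ => hm i)] at h
  simp only [one_mul, Finset.prod_apply] at h
  rw [h, Finset.sum_div, Complex.ofReal_sum, ← Finset.sum_neg_distrib, Complex.exp_sum]
  refine Finset.prod_congr rfl fun i _ => ?_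
  rw [charFun_map_mul_comp (hY i).aemeasurable, (hY i).map_eq, charFun_gaussianReal]
  congr 1
  push_cast
  simp

lemma charFun_expMeasure_one (t : ℝ) : charFun (expMeasure 1) t = 1 / (1 - Complex.I * t) := by
  have hden : (1 - Complex.I * t : ℂ) ≠ 0 := fun h => by
    have := congrArg Complex.re h; simp at this
  have hpdf : ∀ x : ℝ, (gammaPDF 1 1 x).toReal • Complex.exp (t * x * Complex.I) =
      (Set.Ici (0 : ℝ)).indicator (fun x : ℝ => Complex.exp (-(1 - Complex.I * t) * x)) x := by
    intro x
    by_cases hx : 0 ≤ x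
    · rw [Set.indicator_of_mem (show x ∈ Set.Ici (0 : ℝ) from hx), gammaPDF_of_nonneg hx]
      simp only [Real.one_rpow, Real.Gamma_one, div_one, sub_self, Real.rpow_zero, mul_one, one_mul]
      rw [ENNReal.toReal_ofReal (Real.exp_pos _).le, Complex.real_smul, Complex.ofReal_exp,
        ← Complex.exp_add]
      push_cast
      ring_nf
    · rw [Set.indicator_of_notMem (by simpa using hx), gammaPDF_of_neg (not_le.1 hx)]
      simp
  rw [charFun_apply_real, expMeasure, gammaMeasure,
    integral_withDensity_eq_integral_toReal_smul
      (f := gammaPDF 1 1) (measurable_gammaPDFReal 1 1).ennreal_ofReal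
      (.of_forall fun x => by simp [gammaPDF])]
  simp only [hpdf]
  rw [integral_indicator measurableSet_Ici, integral_Ici_eq_integral_Ioi,
    integral_exp_mul_complex_Ioi (by simp)]
  simp only [Complex.ofReal_zero, mul_zero, Complex.exp_zero, div_neg, neg_div, neg_neg]

/-- The integral is a complex square root. Its square, the form needed for two independent copies,
involves no choice of branch. -/
lemma integral_phase_half_sq_gaussian_sq (t : ℝ) :
    (∫ y, phase (t * (y ^ 2 / 2)) ∂(gaussianReal 0 1)) ^ 2 = 1 / (1 - Complex.I * t) := by
  have hden : (1 - Complex.I * t : ℂ) ≠ 0 := fun h => by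
    have := congrArg Complex.re h; simp at this
  rw [integral_gaussianReal_eq_integral_smul (by simp)]
  have h1 : ∀ y : ℝ, gaussianPDFReal 0 1 y • phase (t * (y ^ 2 / 2)) =
      ((√(2 * Real.pi))⁻¹ : ℝ) * Complex.exp (-((1 - Complex.I * t) / 2) * (y : ℂ) ^ 2) := by
    intro y
    rw [gaussianPDFReal_def, Complex.real_smul, phase]
    push_cast
    rw [mul_assoc, ← Complex.exp_add]
    simp only [mul_one, sub_zero]
    congr 2
    ring
  simp only [h1]
  rw [integral_const_mul, integral_gaussian_complex (by simp), mul_pow]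
  have h2 : ((Real.pi / ((1 - Complex.I * t) / 2) : ℂ) ^ (1 / 2 : ℂ)) ^ 2 =
      Real.pi / ((1 - Complex.I * t) / 2) := by
    rw [← Complex.cpow_nat_mul]; simp
  rw [h2, ← Complex.ofReal_pow, inv_pow, Real.sq_sqrt (by positivity)]
  have hpi : (Real.pi : ℂ) ≠ 0 := by exact_mod_cast Real.pi_ne_zero
  push_cast
  field_simp

lemma map_half_sum_sq_gaussian :
    (Measure.infinitePi fun _ : Fin 2 => gaussianReal 0 1).map
      (fun v => (v 0 ^ 2 + v 1 ^ 2) / 2) = expMeasure 1 := by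
  have : IsProbabilityMeasure (expMeasure 1) := isProbabilityMeasure_expMeasure one_pos
  set Q := Measure.infinitePi fun _ : Fin 2 => gaussianReal 0 1 with hQ
  have hind : iIndepFun (fun (i : Fin 2) (v : Fin 2 → ℝ) => v i ^ 2 / 2) Q :=
    iIndepFun_infinitePi (X := fun (_ : Fin 2) (x : ℝ) => x ^ 2 / 2) fun _ => by fun_prop
  have hm : Measurable fun v : Fin 2 → ℝ => (v 0 ^ 2 + v 1 ^ 2) / 2 := by fun_prop
  have : IsProbabilityMeasure (Q.map fun v => (v 0 ^ 2 + v 1 ^ 2) / 2) :=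
    Measure.isProbabilityMeasure_map hm.aemeasurable
  have hmi : ∀ i : Fin 2, Measurable fun v : Fin 2 → ℝ => v i ^ 2 / 2 := fun i => by fun_prop
  refine Measure.ext_of_charFun (funext fun t => ?_)
  have h := congrFun ((hind.indepFun (by decide : (0 : Fin 2) ≠ 1)).charFun_map_fun_add_eq_mul
    (hmi 0).aemeasurable (hmi 1).aemeasurable) t
  have hcoord : ∀ i, charFun (Q.map fun v => v i ^ 2 / 2) t =
      ∫ y, phase (t * (y ^ 2 / 2)) ∂(gaussianReal 0 1) := fun i => by
    rw [charFun_map_real_eq_integral_phase (hmi i).aemeasurable,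
      ← (measurePreserving_eval_infinitePi (fun _ : Fin 2 => gaussianReal 0 1) i).map_eq,
      integral_map (measurable_pi_apply i).aemeasurable
        (Measurable.aestronglyMeasurable (by fun_prop))]
  rw [Pi.mul_apply, hcoord, hcoord, ← sq, integral_phase_half_sq_gaussian_sq] at h
  simp only [add_div]
  rw [h, charFun_expMeasure_one]

end LimitLaws

/-! ### Lévy's continuity theorem for complex vectors -/

section ComplexVectors

variable {Ω Ω' : Type*} [MeasurableSpace Ω] [MeasurableSpace Ω']

lemma charFun_map_toLp_eq_integral_phase (Q : Measure Ω) {q : ℕ} {W : Ω → Fin q → ℂ}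
    (hW : AEMeasurable W Q) (c : PiLp 2 (fun _ : Fin q => ℂ)) :
    charFun (Q.map fun ω => WithLp.toLp 2 (W ω)) c =
      ∫ ω, phase (∑ j, (c j * (starRingEnd ℂ) (W ω j)).re) ∂Q := by
  rw [charFun_apply, integral_map (by fun_prop) (Continuous.aestronglyMeasurable (by fun_prop))]
  refine integral_congr_ae (.of_forall fun ω => ?_)
  simp only [phase]
  rw [mul_comm]
  simp [PiLp.inner_apply, Complex.inner]

/-- Lévy's continuity theorem for vectors of complex random variables. -/
lemma tendstoInDistribution_of_tendsto_integral_phase {μ : Measure Ω} [IsProbabilityMeasure μ]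
    {P : Measure Ω'} [IsProbabilityMeasure P] {q : ℕ} {U : ℕ → Ω → Fin q → ℂ} {V : Ω' → Fin q → ℂ}
    (hU : ∀ n, Measurable (U n)) (hV : AEMeasurable V P)
    (h : ∀ c : Fin q → ℂ, Tendsto (fun n => ∫ ω, phase (∑ j, (c j * (starRingEnd ℂ) (U n ω j)).re) ∂μ)
      atTop (𝓝 (∫ ω, phase (∑ j, (c j * (starRingEnd ℂ) (V ω j)).re) ∂P))) :
    TendstoInDistribution U atTop V (fun _ => μ) P := by
  -- Characteristic functions use an inner product, which the sup norm on `Fin q → ℂ` does not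
  -- provide. Convergence is proved in `PiLp 2` and carried back by the continuous identification.
  have hLp : TendstoInDistribution (fun n ω => WithLp.toLp 2 (U n ω)) atTop
      (fun ω => WithLp.toLp 2 (V ω)) (fun _ => μ) P :=
    { forall_aemeasurable := fun n => by have := hU n; fun_prop
      aemeasurable_limit := by fun_prop
      tendsto := by
        refine ProbabilityMeasure.tendsto_iff_tendsto_charFun.2 fun c => ?_
        simp only [ProbabilityMeasure.coe_mk]
        rw [charFun_map_toLp_eq_integral_phase P hV]
        simp only [fun n => charFun_map_toLp_eq_integral_phase μ (hU n).aemeasurable c]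
        exact h c }
  exact hLp.continuous_comp (g := fun x : PiLp 2 (fun _ : Fin q => ℂ) => WithLp.ofLp x)
    (by fun_prop)

end ComplexVectors

/-! ### Asymptotic normality of the Fourier transforms -/

section PeriodogramLimit

lemma integral_phase_complex_gaussian {Ω : Type*} [MeasurableSpace Ω] {P : Measure Ω}
    [IsProbabilityMeasure P] {q : ℕ} {Y : Fin q × Fin 2 → Ω → ℝ} (hind : iIndepFun Y P)
    (hY : ∀ p, HasLaw (Y p) (gaussianReal 0 1) P) (c : Fin q → ℂ) :
    ∫ ω, phase (∑ j, (c j * (starRingEnd ℂ)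
      ((Y (j, 0) ω : ℂ) + Complex.I * (Y (j, 1) ω : ℂ))).re) ∂P =
      Complex.exp (-((∑ j, ‖c j‖ ^ 2) / 2 : ℝ)) := by
  have h := integral_phase_sum_gaussian hind hY fun p => if p.2 = 0 then (c p.1).re else (c p.1).im
  simp only [Fintype.sum_prod_type, Fin.sum_univ_two] at h
  simp only [if_true, Fin.isValue, one_ne_zero, if_false] at h
  have h1 : ∀ ω, ∑ j, (c j * (starRingEnd ℂ)
      ((Y (j, 0) ω : ℂ) + Complex.I * (Y (j, 1) ω : ℂ))).re =
      ∑ j, ((c j).re * Y (j, 0) ω + (c j).im * Y (j, 1) ω) := fun ω =>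
    Finset.sum_congr rfl fun j _ => by simp
  have h2 : ∑ j, ‖c j‖ ^ 2 = ∑ j, ((c j).re ^ 2 + (c j).im ^ 2) :=
    Finset.sum_congr rfl fun j _ => by
      rw [← Complex.normSq_eq_norm_sq, Complex.normSq_apply]
      ring
  simp only [h1, h2]
  exact h

lemma le_of_iInf_pos {ι : Type*} {F : ι → ℝ} (h : 0 < ⨅ t, F t) (t : ι) : ⨅ t, F t ≤ F t := by
  refine ciInf_le ?_ t
  -- A real infimum that is unbounded below has default value `0`, so positivity already implies
  -- boundedness.
  by_contra hb
  rw [Real.iInf_of_not_bddBelow hb] at h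
  exact lt_irrefl _ h

lemma conj_fourierSum {Ω : Type*} (X : ℤ → Ω → ℝ) (n : ℕ) (θ : ℝ) (ω : Ω) :
    (starRingEnd ℂ) (fourierSum X n θ ω) =
      ∑ t ∈ Finset.Icc 1 n, (X (t : ℤ) ω : ℂ) * phase (-(t * θ)) := by
  rw [fourierSum, map_sum]
  refine Finset.sum_congr rfl fun t _ => ?_
  rw [map_mul, Complex.conj_ofReal, phase_neg, phase]
  push_cast
  rw [mul_assoc]

lemma spectralDensity_eq_cosSeries {Ω : Type*} [MeasurableSpace Ω] {μ : Measure Ω} {X : ℤ → Ω → ℝ} (hr : Summable fun k => |cov μ X k|)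
    (heven : ∀ k, cov μ X (-k) = cov μ X k) (θ : ℝ) :
    spectralDensity μ X θ = cosSeries (cov μ X) θ / (2 * Real.pi) := by
  have h : ∀ k : ℤ, (cov μ X k : ℂ) * Complex.exp (Complex.I * (k : ℂ) * (θ : ℂ)) =
      (cov μ X k : ℂ) * phase (k * θ) := fun k => by
    rw [phase]; push_cast; rw [mul_assoc]
  rw [spectralDensity]
  simp only [h]
  rw [tsum_mul_phase hr heven,
    show (1 / (2 * (Real.pi : ℂ)) * (cosSeries (cov μ X) θ : ℂ)) =
      ((cosSeries (cov μ X) θ / (2 * Real.pi) : ℝ) : ℂ) by push_cast; ring, Complex.ofReal_re]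

lemma measurable_fourierSum {Ω : Type*} [MeasurableSpace Ω] {X : ℤ → Ω → ℝ} (hX : ∀ t, Measurable (X t)) (n : ℕ) (θ : ℝ) :
    Measurable (fourierSum X n θ) := by
  unfold fourierSum
  exact Finset.measurable_fun_sum _ fun t _ =>
    (Complex.measurable_ofReal.comp (hX t)).mul_const _

variable {Ω S : Type*} [MeasurableSpace Ω] [MeasurableSpace S] {μ : Measure Ω}
  [IsProbabilityMeasure μ] {ε : ℤ → Ω → S}

/-- **Joint asymptotic normality of the Fourier transforms** of a causal process at finitely many
Fourier frequencies. -/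
theorem tendsto_integral_phase_fourierSum (hε : ∀ n, Measurable (ε n)) (hindep : iIndepFun ε μ)
    (hident : ∀ n, IdentDistrib (ε n) (ε 0) μ μ) {G : (ℕ → S) → ℝ} (hG : Measurable G)
    (hmean : ∫ ω, causalProcess G ε 0 ω ∂μ = 0) (hL2 : MemLp (causalProcess G ε 0) 2 μ)
    (hκ : ∑' k : ℕ, eLpNorm (proj μ ε 0 (causalProcess G ε (k : ℤ))) 2 μ < ∞)
    (hf : 0 < ⨅ t : ℝ, spectralDensity μ (causalProcess G ε) t)
    {q : ℕ} {l : ℕ → Fin q → ℕ} (hl_inj : ∀ᶠ n in atTop, Function.Injective (l n))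
    (hl_mem : ∀ᶠ n in atTop, ∀ j, 1 ≤ l n j ∧ l n j ≤ (n - 1) / 2) (c : Fin q → ℂ) :
    Tendsto (fun n : ℕ => ∫ ω, phase (∑ j, (c j * (starRingEnd ℂ)
      (fourierSum (causalProcess G ε) n (fourierFreq n (l n j)) ω /
        (Real.sqrt ((n : ℝ) * Real.pi *
          spectralDensity μ (causalProcess G ε) (fourierFreq n (l n j))) : ℂ))).re) ∂μ)
      atTop (𝓝 (Complex.exp (-((∑ j, ‖c j‖ ^ 2) / 2 : ℝ)))) := by
  set ν := μ.map (ε 0) with hν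
  have : IsProbabilityMeasure ν := Measure.isProbabilityMeasure_map (hε 0).aemeasurable
  have hlaw := measurePreserving_pastSeq ν hε hindep fun n => (hident n).map_eq
  set X : ℤ → Ω → ℝ := causalProcess G ε with hX
  have hXG : X = fun n ω => G (pastSeq ε n ω) := rfl
  have h2 : MemLp G 2 (seqMeasure ν) := by
    rw [← (hlaw 0).map_eq]
    exact (memLp_map_measure_iff (by rw [(hlaw 0).map_eq]; exact hG.aestronglyMeasurable)
      (hlaw 0).measurable.aemeasurable).2 hL2
  have h0 : ∫ v, G v ∂(seqMeasure ν) = 0 := by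
    rw [← integral_comp_pastSeq ν hlaw hG.aestronglyMeasurable 0]; exact hmean
  have hs := summable_lpNorm_incrIter ν hlaw hG h2 hκ
  have hr : Summable fun k => |cov μ X k| := summable_abs_cov ν hlaw hG h2 h0 hs
  have heven : ∀ k, cov μ X (-k) = cov μ X k := cov_neg ν hlaw h2
  set F : ℝ → ℝ := spectralDensity μ X with hF
  set δ := ⨅ t, F t with hδ
  have hδF : ∀ t, δ ≤ F t := le_of_iInf_pos hf
  have hF0 : ∀ t, 0 < F t := fun t => hf.trans_le (hδF t)
  -- The normalization without its factor `√n`; the amplitudes stay bounded because `F ≥ δ > 0`.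
  set A : ℕ → Fin q → ℂ := fun n j => c j / (√(Real.pi * F (fourierFreq n (l n j))) : ℂ) with hA
  have hnA : ∀ n j, ‖A n j‖ = ‖c j‖ / √(Real.pi * F (fourierFreq n (l n j))) := fun n j => by
    rw [hA, norm_div, Complex.norm_real, Real.norm_of_nonneg (Real.sqrt_nonneg _)]
  have hAb : ∀ n j, ‖A n j‖ ≤ (∑ i, ‖c i‖) / √(Real.pi * δ) := fun n j => by
    rw [hnA]
    have hpos : 0 < √(Real.pi * δ) := Real.sqrt_pos.2 (mul_pos Real.pi_pos hf)
    refine div_le_div₀ (Finset.sum_nonneg fun i _ => norm_nonneg _)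
      (Finset.single_le_sum (f := fun i => ‖c i‖) (fun i _ => norm_nonneg _) (Finset.mem_univ j))
      hpos (Real.sqrt_le_sqrt (mul_le_mul_of_nonneg_left (hδF _) Real.pi_pos.le))
  -- The eigenvalue `2πF` cancels against `‖A n j‖² / 2 = ‖c j‖² / (2πF)`, for every `n` and
  -- wherever the frequencies lie.
  have hv : ∀ n, ∑ j, cosSeries (cov μ X) (fourierFreq n (l n j)) * (‖A n j‖ ^ 2 / 2) =
      ∑ j, ‖c j‖ ^ 2 := fun n => by
    refine Finset.sum_congr rfl fun j _ => ?_
    have hpos := hF0 (fourierFreq n (l n j))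
    have e : cosSeries (cov μ X) (fourierFreq n (l n j)) =
        2 * Real.pi * F (fourierFreq n (l n j)) := by
      rw [hF, spectralDensity_eq_cosSeries hr heven]
      field_simp
    rw [hnA, e, div_pow, Real.sq_sqrt (mul_pos Real.pi_pos hpos).le]
    field_simp
  set w : ℕ → ℕ → ℝ := fun n t => ∑ j, (A n j * phase (-(t * fourierFreq n (l n j)))).re with hw
  have hwb : ∀ n t, |w n t| ≤ q * ((∑ i, ‖c i‖) / √(Real.pi * δ)) := fun n t => by
    refine (Finset.abs_sum_le_sum_abs _ _).trans ?_
    refine (Finset.sum_le_card_nsmul _ _ ((∑ i, ‖c i‖) / √(Real.pi * δ)) fun j _ => ?_).trans (by simp)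
    refine (Complex.abs_re_le_norm _).trans ?_
    rw [norm_mul, norm_phase, mul_one]
    exact hAb n j
  have hvar : Tendsto (fun n : ℕ => ∫ ω, (∑ t ∈ Finset.Icc 1 n,
      w n t / √n * G (pastSeq ε (t : ℤ) ω)) ^ 2 ∂μ) atTop (𝓝 (∑ j, ‖c j‖ ^ 2)) := by
    refine (tendsto_toeplitz_trig hr heven hl_inj hl_mem A hAb hv).congr fun n => ?_
    rw [integral_sq_sum (Z := fun (t : ℕ) ω => w n t / √n * G (pastSeq ε (t : ℤ) ω)) _
      fun t _ => (memLp_comp_pastSeq ν hlaw h2 _).const_mul _, Finset.sum_comm, Finset.sum_div]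
    refine Finset.sum_congr rfl fun s _ => ?_
    rw [Finset.sum_div]
    refine Finset.sum_congr rfl fun t _ => ?_
    have e : ∀ ω, w n s / √n * G (pastSeq ε (s : ℤ) ω) * (w n t / √n * G (pastSeq ε (t : ℤ) ω)) =
        w n t * w n s / n * (G (pastSeq ε (s : ℤ) ω) * G (pastSeq ε (t : ℤ) ω)) := fun ω => by
      have hn : √(n : ℝ) * √n = n := Real.mul_self_sqrt (Nat.cast_nonneg n)
      calc _ = w n t * w n s / (√(n : ℝ) * √n) *
            (G (pastSeq ε (s : ℤ) ω) * G (pastSeq ε (t : ℤ) ω)) := by ring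
        _ = _ := by rw [hn]
    simp only [e]
    rw [integral_const_mul, integral_pastSeq_mul_eq_cov ν hlaw h2, ← hXG]
    ring
  have hclt := tendsto_integral_phase_weighted_sum ν hε hindep hlaw hG h2 h0 hs w hwb hvar
  refine hclt.congr fun n => integral_congr_ae (.of_forall fun ω => congrArg phase ?_)
  have hterm : ∀ j, (c j * (starRingEnd ℂ) (fourierSum X n (fourierFreq n (l n j)) ω /
        (√((n : ℝ) * Real.pi * F (fourierFreq n (l n j))) : ℂ))).re =
      ∑ t ∈ Finset.Icc 1 n, (A n j * phase (-(t * fourierFreq n (l n j)))).re / √n *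
        G (pastSeq ε (t : ℤ) ω) := fun j => by
    rw [map_div₀, Complex.conj_ofReal, conj_fourierSum, mul_assoc (n : ℝ),
      Real.sqrt_mul (Nat.cast_nonneg n), Finset.sum_div, Finset.mul_sum, Complex.re_sum]
    refine Finset.sum_congr rfl fun t _ => ?_
    rw [div_mul_eq_mul_div, ← Complex.re_mul_ofReal, ← Complex.div_ofReal_re]
    congr 1
    simp only [hA, hXG]
    push_cast
    ring
  simp only [hterm]
  rw [Finset.sum_comm]
  refine Finset.sum_congr rfl fun t _ => ?_
  simp only [hw, Finset.sum_div, Finset.sum_mul]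

end PeriodogramLimit

/-! ### Joint convergence in distribution -/

section JointLimits

/-- Used to pass from a Gaussian model, where the periodogram limit is computed, to arbitrary
exponential variables on another space. -/
lemma TendstoInDistribution.of_map_limit_eq {E Ω Ω' Ω'' : Type*} [MeasurableSpace Ω]
    [MeasurableSpace Ω'] [MeasurableSpace Ω''] [MeasurableSpace E] [TopologicalSpace E]
    [OpensMeasurableSpace E] {μ : Measure Ω} [IsProbabilityMeasure μ] {P : Measure Ω'}
    [IsProbabilityMeasure P] {Q : Measure Ω''} [IsProbabilityMeasure Q] {U : ℕ → Ω → E}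
    {V : Ω' → E} {W : Ω'' → E} (h : TendstoInDistribution U atTop V (fun _ => μ) P)
    (hW : AEMeasurable W Q) (hlaw : P.map V = Q.map W) :
    TendstoInDistribution U atTop W (fun _ => μ) Q where
  forall_aemeasurable := h.forall_aemeasurable
  aemeasurable_limit := hW
  tendsto := by
    have e : (⟨Q.map W, Measure.isProbabilityMeasure_map hW⟩ : ProbabilityMeasure E) =
        ⟨P.map V, Measure.isProbabilityMeasure_map h.aemeasurable_limit⟩ := Subtype.ext hlaw.symm
    rw [e]
    exact h.tendsto

/-- The standard Gaussian law of `q` pairs of real random variables. -/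
def gaussianPairs (q : ℕ) : Measure (Fin q → Fin 2 → ℝ) :=
  Measure.infinitePi fun _ => Measure.infinitePi fun _ => gaussianReal 0 1

instance (q : ℕ) : IsProbabilityMeasure (gaussianPairs q) := by
  unfold gaussianPairs; infer_instance

lemma iIndepFun_gaussianPairs (q : ℕ) :
    iIndepFun (fun (p : Fin q × Fin 2) v => v p.1 p.2) (gaussianPairs q) :=
  iIndepFun_uncurry_infinitePi' (X := fun (_ : Fin q) (_ : Fin 2) (x : ℝ) => x)
    (fun _ _ => gaussianReal 0 1) fun _ _ => measurable_id

lemma hasLaw_gaussianPairs (q : ℕ) (p : Fin q × Fin 2) :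
    HasLaw (fun v => v p.1 p.2) (gaussianReal 0 1) (gaussianPairs q) :=
  ((measurePreserving_eval_infinitePi (fun _ : Fin 2 => gaussianReal 0 1) p.2).comp
    (measurePreserving_eval_infinitePi
      (fun _ : Fin q => Measure.infinitePi fun _ : Fin 2 => gaussianReal 0 1) p.1)).hasLaw

lemma map_half_sum_sq_gaussianPairs (q : ℕ) :
    (gaussianPairs q).map (fun v j => (v j 0 ^ 2 + v j 1 ^ 2) / 2) =
      Measure.infinitePi fun _ : Fin q => expMeasure 1 := by
  have h := Measure.infinitePi_map_pi
    (μ := fun _ : Fin q => Measure.infinitePi fun _ : Fin 2 => gaussianReal 0 1)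
    (f := fun _ v => (v 0 ^ 2 + v 1 ^ 2) / 2) fun _ => by fun_prop
  rw [gaussianPairs, h]
  simp only [map_half_sum_sq_gaussian]

/-- The factor `1 / 2` is the ratio of the normalizations `πn` and `2πn`. At `n = 0` both sides are
`0` by division by zero. -/
lemma periodogram_div_eq (n : ℕ) {F : ℝ} (hF : 0 < F) {Ω : Type*} (X : ℤ → Ω → ℝ) (θ : ℝ) (ω : Ω) :
    periodogram X n θ ω / F =
      ‖fourierSum X n θ ω / (√((n : ℝ) * Real.pi * F) : ℂ)‖ ^ 2 / 2 := by
  rw [norm_div, Complex.norm_real, Real.norm_of_nonneg (Real.sqrt_nonneg _), div_pow,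
    Real.sq_sqrt (mul_nonneg (mul_nonneg (Nat.cast_nonneg n) Real.pi_pos.le) hF.le), periodogram]
  ring

variable {Ω S : Type*} [MeasurableSpace Ω] [MeasurableSpace S] {μ : Measure Ω}
  [IsProbabilityMeasure μ] {ε : ℤ → Ω → S}

theorem tendstoInDistribution_fourierSum (hε : ∀ n, Measurable (ε n)) (hindep : iIndepFun ε μ)
    (hident : ∀ n, IdentDistrib (ε n) (ε 0) μ μ) {G : (ℕ → S) → ℝ} (hG : Measurable G)
    (hmean : ∫ ω, causalProcess G ε 0 ω ∂μ = 0) (hL2 : MemLp (causalProcess G ε 0) 2 μ)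
    (hκ : ∑' k : ℕ, eLpNorm (proj μ ε 0 (causalProcess G ε (k : ℤ))) 2 μ < ∞)
    (hf : 0 < ⨅ t : ℝ, spectralDensity μ (causalProcess G ε) t)
    {q : ℕ} {l : ℕ → Fin q → ℕ} (hl_inj : ∀ᶠ n in atTop, Function.Injective (l n))
    (hl_mem : ∀ᶠ n in atTop, ∀ j, 1 ≤ l n j ∧ l n j ≤ (n - 1) / 2)
    {Ω' : Type*} [MeasurableSpace Ω'] {P : Measure Ω'} [IsProbabilityMeasure P]
    {Y : Fin q × Fin 2 → Ω' → ℝ} (hY : iIndepFun Y P)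
    (hYlaw : ∀ p, HasLaw (Y p) (gaussianReal 0 1) P) :
    TendstoInDistribution (fun (n : ℕ) ω j =>
      fourierSum (causalProcess G ε) n (fourierFreq n (l n j)) ω /
        (√((n : ℝ) * Real.pi *
          spectralDensity μ (causalProcess G ε) (fourierFreq n (l n j))) : ℂ))
      atTop (fun ω j => (Y (j, 0) ω : ℂ) + Complex.I * (Y (j, 1) ω : ℂ)) (fun _ => μ) P := by
  have hXm : ∀ t, Measurable (causalProcess G ε t) := fun t => hG.comp (measurable_pastSeq hε t)
  have hYm := fun p => (hYlaw p).aemeasurable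
  refine tendstoInDistribution_of_tendsto_integral_phase
    (fun n => measurable_pi_lambda _ fun j => (measurable_fourierSum hXm n _).div_const _)
    (aemeasurable_pi_lambda _ fun j => (Complex.measurable_ofReal.comp_aemeasurable (hYm _)).add
      ((Complex.measurable_ofReal.comp_aemeasurable (hYm _)).const_mul _)) fun c => ?_
  rw [integral_phase_complex_gaussian hY hYlaw]
  exact tendsto_integral_phase_fourierSum hε hindep hident hG hmean hL2 hκ hf hl_inj hl_mem c

theorem tendstoInDistribution_periodogram (hε : ∀ n, Measurable (ε n)) (hindep : iIndepFun ε μ)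
    (hident : ∀ n, IdentDistrib (ε n) (ε 0) μ μ) {G : (ℕ → S) → ℝ} (hG : Measurable G)
    (hmean : ∫ ω, causalProcess G ε 0 ω ∂μ = 0) (hL2 : MemLp (causalProcess G ε 0) 2 μ)
    (hκ : ∑' k : ℕ, eLpNorm (proj μ ε 0 (causalProcess G ε (k : ℤ))) 2 μ < ∞)
    (hf : 0 < ⨅ t : ℝ, spectralDensity μ (causalProcess G ε) t)
    {q : ℕ} {l : ℕ → Fin q → ℕ} (hl_inj : ∀ᶠ n in atTop, Function.Injective (l n))
    (hl_mem : ∀ᶠ n in atTop, ∀ j, 1 ≤ l n j ∧ l n j ≤ (n - 1) / 2)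
    {Ω' : Type*} [MeasurableSpace Ω'] {P : Measure Ω'} [IsProbabilityMeasure P]
    {E : Fin q → Ω' → ℝ} (hE : iIndepFun E P) (hElaw : ∀ j, HasLaw (E j) (expMeasure 1) P) :
    TendstoInDistribution (fun (n : ℕ) ω j =>
      periodogram (causalProcess G ε) n (fourierFreq n (l n j)) ω /
        spectralDensity μ (causalProcess G ε) (fourierFreq n (l n j)))
      atTop (fun ω j => E j ω) (fun _ => μ) P := by
  have h := (tendstoInDistribution_fourierSum hε hindep hident hG hmean hL2 hκ hf hl_inj hl_mem
    (iIndepFun_gaussianPairs q) (hasLaw_gaussianPairs q)).continuous_comp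
      (g := fun (z : Fin q → ℂ) (j : Fin q) => ‖z j‖ ^ 2 / 2) (by fun_prop)
  have hEm : AEMeasurable (fun ω j => E j ω) P :=
    aemeasurable_pi_lambda _ fun j => (hElaw j).aemeasurable
  have hU : (fun (n : ℕ) ω j => periodogram (causalProcess G ε) n (fourierFreq n (l n j)) ω /
        spectralDensity μ (causalProcess G ε) (fourierFreq n (l n j))) =
      fun n => (fun (z : Fin q → ℂ) (j : Fin q) => ‖z j‖ ^ 2 / 2) ∘ fun ω j =>
        fourierSum (causalProcess G ε) n (fourierFreq n (l n j)) ω /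
          (√((n : ℝ) * Real.pi *
            spectralDensity μ (causalProcess G ε) (fourierFreq n (l n j))) : ℂ) := by
    ext n ω j
    exact periodogram_div_eq n (hf.trans_le (le_of_iInf_pos hf _)) _ _ _
  rw [hU]
  refine TendstoInDistribution.of_map_limit_eq h hEm ?_
  rw [(hE.hasLaw_infinitePi hElaw hEm).map_eq, ← map_half_sum_sq_gaussianPairs]
  congr 1
  ext v j
  simp only [Function.comp_apply]
  rw [← Complex.normSq_eq_norm_sq, Complex.normSq_apply]
  simp
  ring

end JointLimits

end SpectralTS

end

/-! ### The corollary -/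

theorem corollary2p1
    {Ω S Ω₁ Ω₂ : Type*} [MeasurableSpace Ω] [MeasurableSpace S]
    (μ : Measure Ω) [IsProbabilityMeasure μ]
    -- the i.i.d. innovations
    (ε : ℤ → Ω → S) (hε_meas : ∀ n, Measurable (ε n)) (hε_indep : iIndepFun ε μ)
    (hε_ident : ∀ n, IdentDistrib (ε n) (ε 0) μ μ)
    -- the causal process
    (G : (ℕ → S) → ℝ) (hG : Measurable G)
    (X : ℤ → Ω → ℝ) (hX : X = SpectralTS.causalProcess G ε)
    -- mean zero and square integrable
    (hX_mean : ∀ t, ∫ ω, X t ω ∂μ = 0) (hX_L2 : ∀ t, MemLp (X t) 2 μ)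
    -- the sum over k ≥ 0 of the L² norms of `P 0 (X k)` is finite
    (hκ : ∑' k : ℕ, eLpNorm (SpectralTS.proj μ ε 0 (X (k : ℤ))) 2 μ < ∞)
    -- the spectral density is bounded away from zero
    (hf : 0 < ⨅ t : ℝ, SpectralTS.spectralDensity μ X t)
    -- the indices `l n 0 < ⋯ < l n (q - 1)` in `{1, …, ⌊(n - 1) / 2⌋}`, as soon as `n` is large
    (q : ℕ) (l : ℕ → Fin q → ℕ)
    (hl_mono : ∀ᶠ n in atTop, StrictMono (l n))
    (hl_mem : ∀ᶠ n in atTop, ∀ j, 1 ≤ l n j ∧ l n j ≤ (n - 1) / 2) :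
    -- joint convergence of the normalized Fourier transforms
    (∀ [MeasurableSpace Ω₁] (P : Measure Ω₁) [IsProbabilityMeasure P]
        (Y : Fin (2 * q) → Ω₁ → ℝ),
      iIndepFun Y P → (∀ k, HasLaw (Y k) (gaussianReal 0 1) P) →
      TendstoInDistribution
        (fun (n : ℕ) (ω : Ω) (j : Fin q) =>
          SpectralTS.fourierSum X n (SpectralTS.fourierFreq n (l n j)) ω /
            (Real.sqrt ((n : ℝ) * Real.pi *
              SpectralTS.spectralDensity μ X (SpectralTS.fourierFreq n (l n j))) : ℂ))
        atTop
        (fun (ω : Ω₁) (j : Fin q) =>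
          (Y ⟨2 * (j : ℕ), by omega⟩ ω : ℂ) +
            Complex.I * (Y ⟨2 * (j : ℕ) + 1, by omega⟩ ω : ℂ))
        (fun _ => μ) P) ∧
    -- joint convergence of the normalized periodogram ordinates
    (∀ [MeasurableSpace Ω₂] (P : Measure Ω₂) [IsProbabilityMeasure P]
        (E : Fin q → Ω₂ → ℝ),
      iIndepFun E P → (∀ j, HasLaw (E j) (expMeasure 1) P) →
      TendstoInDistribution
        (fun (n : ℕ) (ω : Ω) (j : Fin q) =>
          SpectralTS.periodogram X n (SpectralTS.fourierFreq n (l n j)) ω /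
            SpectralTS.spectralDensity μ X (SpectralTS.fourierFreq n (l n j)))
        atTop
        (fun (ω : Ω₂) (j : Fin q) => E j ω)
        (fun _ => μ) P) := by
  subst hX
  have hl_inj : ∀ᶠ n in atTop, Function.Injective (l n) := hl_mono.mono fun n h => h.injective
  refine ⟨fun P _ Y hY hYlaw => ?_, fun P _ E hE hElaw =>
    SpectralTS.tendstoInDistribution_periodogram hε_meas hε_indep hε_ident hG (hX_mean 0)
      (hX_L2 0) hκ hf hl_inj hl_mem hE hElaw⟩
  -- The pair `(j, a)` is placed at index `2j + a`, so that real and imaginary parts alternate as in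
  -- the flat list of normals.
  have hinj : Function.Injective fun p : Fin q × Fin 2 =>
      (⟨2 * (p.1 : ℕ) + (p.2 : ℕ), by omega⟩ : Fin (2 * q)) := by
    rintro ⟨i, a⟩ ⟨j, b⟩ h
    have h' : 2 * (i : ℕ) + a = 2 * (j : ℕ) + b := congrArg Fin.val h
    refine Prod.ext (Fin.ext ?_) (Fin.ext ?_) <;> simp only <;> omega
  exact SpectralTS.tendstoInDistribution_fourierSum hε_meas hε_indep hε_ident hG (hX_mean 0)
    (hX_L2 0) hκ hf hl_inj hl_mem (hY.precomp hinj) fun p => hYlaw _
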